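/- Let $\mathbb C^{2,1}$ be $\mathbb C^3$ with the Hermitian form $\langle z,w\rangle=z_1\bar w_3+z_2\bar w_2+z_3\bar w_1$, let $H^2_{\mathbb C}$ be the complex hyperbolic plane (the projectivisation of the set of vectors with $\langle z,z\rangle<0$) with the Bergman metric $\cosh^2\left(\tfrac12\operatorname{dist}([z],[w])\right)=\frac{\langle z,w\rangle\langle w,z\rangle}{\langle z,z\rangle\langle w,w\rangle}$, and let $\mathrm{PU}(2,1)$ be its holomorphic isometry group. A complex geodesic is a set $C=\{[z]\in H^2_{\mathbb C} : \langle z,c\rangle=0\}$ with $\langle c,c\rangle>0$; the complex reflection of order $2$ in $C$ is $I_C(z)=-z+2\frac{\langle z,c\rangle}{\langle c,c\rangle}c$. For $m_1,m_2,m_3\ge0$, an $[m_1,m_2,m_3]$-triangle is a triple $(C_1,C_2,C_3)$ of complex geodesics such that, for each $j$ (indices mod $3$), $C_{j-1}$ and $C_{j+1}$ do not meet in $H^2_{\mathbb C}$ and are at distance $m_j$ (for $m_j=0$: they are distinct and intersect on the ideal boundary). An ultra-parallel complex hyperbolic $[m_1,m_2,m_3]$-triangle group representation is a homomorphism from $\Gamma=\langle\gamma_1,\gamma_2,\gamma_3\mid\gamma_1^2=\gamma_2^2=\gamma_3^2=1\rangle=(\mathbb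 Z/2\mathbb Z)^{*3}$ to $\mathrm{PU}(2,1)$ that sends each $\gamma_j$ to the complex reflection $I_j$ of order $2$ in the side $C_j$ of such a triangle. It is faithful if it is injective, and discrete if its image is a discrete subgroup of $\mathrm{PU}(2,1)$. An element of $\mathrm{PU}(2,1)$ is elliptic if it has at least one fixed point in $H^2_{\mathbb C}$. Suppose that $m_1\ge m_2>0$, let $r_j=\cosh(m_j/2)$ for $j=1,2$, and suppose that for some integer $k\ge1$ $$\max\left\{\frac1k+\frac{k+1}{r_2^2-1},\ \frac2k\right\}\le\frac{r_1^2-1}{r_2^2-1}-1\le\frac{2}{k-1},$$ where the second inequality is omitted for $k=1$. Then an ultra-parallel complex hyperbolic $[m_1,m_2,0]$-triangle group representation is discrete and faithful if and only if the element $w_A^{(k)}=I_1(I_2I_1)^kI_3$ is non-elliptic. -/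

import Mathlib

open scoped LinearAlgebra.Projectivization Matrix ComplexConjugate

noncomputable section

namespace CHyp

/-- The Hermitian form of signature `(2,1)` on `ℂ³`:
`⟨z, w⟩ = z₁ w̄₃ + z₂ w̄₂ + z₃ w̄₁` (coordinates are numbered from `0` here). -/
def herm (z w : Fin 3 → ℂ) : ℂ :=
  z 0 * conj (w 2) + z 1 * conj (w 1) + z 2 * conj (w 0)

/-- `⟨z, z⟩`, which is a real number. -/
def hnorm (z : Fin 3 → ℂ) : ℝ := (herm z z).re

theorem herm_self (z : Fin 3 → ℂ) : herm z z = (hnorm z : ℂ) := by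
  apply Complex.ext <;> simp [hnorm, herm] <;> ring

/-- The complex hyperbolic plane: the negative lines in `ℂ³`. (The sign of `⟨v, v⟩` does not
depend on the choice of the nonzero vector `v` of the line.) -/
def HC2 : Type := {p : ℙ ℂ (Fin 3 → ℂ) // hnorm p.rep < 0}

/-- A vector spanning the given negative line. -/
def HC2.vec (p : HC2) : Fin 3 → ℂ := p.1.rep

/-- The Bergman distance, `cosh² (dist / 2) = ⟨z, w⟩⟨w, z⟩ / (⟨z, z⟩⟨w, w⟩)`;
the quotient does not depend on the choice of the vectors of the two lines. -/
def bergmanDist (p q : HC2) : ℝ :=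
  2 * Real.arcosh
    (Real.sqrt ((herm p.vec q.vec * herm q.vec p.vec).re / (hnorm p.vec * hnorm q.vec)))

/-- Positive vectors; each is a polar vector of a complex geodesic, and each complex geodesic has
a polar vector, unique up to a scalar. -/
def PolarVector : Type := {c : Fin 3 → ℂ // 0 < hnorm c}

/-- The complex geodesic with the given polar vector, as a subset of the complex hyperbolic
plane. -/
def geodesic (c : PolarVector) : Set HC2 := {p | herm p.vec c.1 = 0}

/-- The distance between two subsets of the complex hyperbolic plane: the infimum of the
Bergman distances. -/
def setDist (C D : Set HC2) : ℝ := sInf (Set.image2 bergmanDist C D)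

/-- `U(2,1)`: the complex linear automorphisms of `ℂ³` preserving the Hermitian form. -/
def U21 : Subgroup (GL (Fin 3) ℂ) where
  carrier := {A | ∀ z w, herm (A.1 *ᵥ z) (A.1 *ᵥ w) = herm z w}
  one_mem' := by intro z w; simp
  mul_mem' := by
    intro A B hA hB z w
    have := hA (B.1 *ᵥ z) (B.1 *ᵥ w)
    rw [hB z w] at this
    simpa [Matrix.mulVec_mulVec] using this
  inv_mem' := by
    intro A hA z w
    have := hA (A⁻¹.1 *ᵥ z) (A⁻¹.1 *ᵥ w)
    simp only [Matrix.mulVec_mulVec, Units.mul_inv, Matrix.one_mulVec] at this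
    exact this.symm

/-- The subgroup of scalar matrices in `U(2,1)`. -/
def scalars : Subgroup U21 where
  carrier := {A | ∃ μ : ℂ, (A.1.1 : Matrix (Fin 3) (Fin 3) ℂ) = μ • 1}
  one_mem' := ⟨1, by simp⟩
  mul_mem' := by
    rintro A B ⟨a, ha⟩ ⟨b, hb⟩
    exact ⟨a * b, by simp [ha, hb, smul_smul, mul_comm]⟩
  inv_mem' := by
    rintro A ⟨a, ha⟩
    have h : (A.1.1 : Matrix (Fin 3) (Fin 3) ℂ) * A.1⁻¹.1 = 1 := Units.mul_inv _
    have ha0 : a ≠ 0 := by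
      rintro rfl
      rw [ha] at h
      simp at h
    refine ⟨a⁻¹, ?_⟩
    rw [ha] at h
    have h2 : a • (A.1⁻¹.1 : Matrix (Fin 3) (Fin 3) ℂ) = 1 := by simpa using h
    change (A.1⁻¹.1 : Matrix (Fin 3) (Fin 3) ℂ) = _
    rw [← h2, smul_smul, inv_mul_cancel₀ ha0, one_smul]

instance scalars_normal : scalars.Normal where
  conj_mem := by
    rintro A ⟨a, ha⟩ B
    refine ⟨a, ?_⟩
    change (B.1.1 : Matrix (Fin 3) (Fin 3) ℂ) * A.1.1 * B.1⁻¹.1 = _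
    rw [ha]
    simp

/-- `PU(2,1)`, the holomorphic isometry group of the complex hyperbolic plane, with the quotient
of the topology of the matrix group `U(2,1)`. -/
abbrev PU21 : Type := U21 ⧸ scalars

/-- The isometry `g` fixes the point `p`. -/
def Fixes (g : PU21) (p : HC2) : Prop :=
  ∃ A : U21, (A : PU21) = g ∧ ∃ μ : ℂ, A.1.1 *ᵥ p.vec = μ • p.vec

/-- An isometry is elliptic if it fixes at least one point of the complex hyperbolic plane. -/
def IsElliptic (g : PU21) : Prop := ∃ p : HC2, Fixes g p

/-- The matrix of `z ↦ -z + 2 ⟨z, c⟩ / ⟨c, c⟩ c`. -/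
def inversionMatrix (c : Fin 3 → ℂ) : Matrix (Fin 3) (Fin 3) ℂ :=
  -1 + (2 / herm c c) • Matrix.vecMulVec c ![conj (c 2), conj (c 1), conj (c 0)]

theorem inversionMatrix_mulVec (c z : Fin 3 → ℂ) :
    inversionMatrix c *ᵥ z = -z + (2 * herm z c / herm c c) • c := by
  funext i
  fin_cases i <;>
    simp [inversionMatrix, Matrix.mulVec, dotProduct, Fin.sum_univ_three, herm] <;> ring

theorem inversionMatrix_sq {c : Fin 3 → ℂ} (hc : herm c c ≠ 0) :
    inversionMatrix c * inversionMatrix c = 1 := by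
  apply Matrix.toLin'.injective
  refine LinearMap.ext fun z => ?_
  have h : herm (-z + (2 * herm z c / herm c c) • c) c = herm z c := by
    have : herm (-z + (2 * herm z c / herm c c) • c) c
        = -herm z c + (2 * herm z c / herm c c) * herm c c := by
      simp [herm]; ring
    rw [this]; field_simp; ring
  rw [Matrix.toLin'_apply, Matrix.toLin'_apply, ← Matrix.mulVec_mulVec, inversionMatrix_mulVec,
    inversionMatrix_mulVec, h]
  simp

theorem inversionMatrix_herm {c : Fin 3 → ℂ} (hc : herm c c ≠ 0) (z w : Fin 3 → ℂ) :
    herm (inversionMatrix c *ᵥ z) (inversionMatrix c *ᵥ w) = herm z w := by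
  rw [inversionMatrix_mulVec, inversionMatrix_mulVec]
  have hs : ∀ x y, conj (herm x y) = herm y x := by
    intro x y; simp [herm]; ring
  have : ∀ a b : ℂ, herm (-z + a • c) (-w + b • c)
      = herm z w - conj b * herm z c - a * herm c w + a * conj b * herm c c := by
    intro a b; simp [herm]; ring
  rw [this]
  simp only [map_div₀, map_mul, hs, Complex.conj_ofNat]
  field_simp
  ring

/-- The inversion in the complex geodesic with polar vector `c`, as an element of `U(2,1)`. -/
def inversionU (c : PolarVector) : U21 :=
  have hc : herm c.1 c.1 ≠ 0 := by
    rw [herm_self]; exact_mod_cast c.2.ne'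
  ⟨⟨inversionMatrix c.1, inversionMatrix c.1, inversionMatrix_sq hc, inversionMatrix_sq hc⟩,
    inversionMatrix_herm hc⟩

/-- The complex reflection of order `2` in the complex geodesic with polar vector `c`. -/
def reflection (c : PolarVector) : PU21 := (inversionU c : PU21)

/-- The complex geodesics with polar vectors `c 0, c 1, c 2` form an `[m₁, m₂, m₃]`-triangle:
for each `j` the sides `C_{j-1}` and `C_{j+1}` (indices modulo `3`) do not meet in the complex
hyperbolic plane and are at distance `m_j`. If `m_j = 0`, this says that the two sides are
distinct and intersect on the ideal boundary. -/
def IsTriangle (m : Fin 3 → ℝ) (c : Fin 3 → PolarVector) : Prop :=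
  ∀ j : Fin 3, Disjoint (geodesic (c (j - 1))) (geodesic (c (j + 1))) ∧
    setDist (geodesic (c (j - 1))) (geodesic (c (j + 1))) = m j

/-- The abstract group `⟨γ₁, γ₂, γ₃ | γ₁² = γ₂² = γ₃² = 1⟩`, the free product of three copies of
`ℤ/2ℤ`. -/
abbrev TriangleGroup : Type := Monoid.CoprodI (fun _ : Fin 3 => Multiplicative (ZMod 2))

/-- The standard generators of the free product (`γ 0, γ 1, γ 2` are `γ₁, γ₂, γ₃`). -/
def γ (j : Fin 3) : TriangleGroup :=
  Monoid.CoprodI.of (M := fun _ : Fin 3 => Multiplicative (ZMod 2)) (i := j)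
    (Multiplicative.ofAdd 1)

/-- `ρ` is an `[m₁, m₂, m₃]`-triangle group representation: it sends the generators to the
complex reflections of order `2` in the sides of an `[m₁, m₂, m₃]`-triangle. -/
def IsTriangleRep (m : Fin 3 → ℝ) (ρ : TriangleGroup →* PU21) : Prop :=
  ∃ c : Fin 3 → PolarVector, IsTriangle m c ∧ ∀ j, ρ (γ j) = reflection (c j)

/-- A representation is discrete if its image is a discrete subgroup of `PU(2,1)`. -/
def IsDiscreteRep (ρ : TriangleGroup →* PU21) : Prop := DiscreteTopology ρ.range

end CHyp

end

namespace CHyp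

/-! ### Hermitian algebra -/

/-! Necessity is general. In a discrete group an elliptic element has finite order, because its
powers stay in a compact set and accumulate at the identity (`exists_pow_eq_one_of_isElliptic`). The
word behind `w_A^{(k)}` has infinite order in the free product (`pow_word_ne_one`), so an elliptic
image contradicts injectivity.

Sufficiency is a ping-pong in the plane seen from the ideal vertex `e` of the first two sides. Polar
vectors can be scaled to `u + μe`, `u + (μ+κ)e` and `v`, with `|μ| = r₂` and `|μ+κ| = r₁`
(`exists_isNormalForm`). In the coordinate `ξ = ⟨z,u⟩/⟨z,e⟩` the first two reflections are the
half-turns about `-conj μ` and `-conj (μ+κ)`, and the third sends everything outside the open unit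
disc into it (`IsFrame.norm_sq_lt`). The infinite dihedral group of half-turns carries the unit disc
to unit discs centred at `-2 conj (μ+nκ)` and `-2n conj κ`. These miss the original disc as soon as
`|μ+nκ| ≥ 1` for every integer `n` and `|κ| ≥ 1`; ping-pong then gives faithfulness and discreteness
(`isDiscreteRep_and_injective`).

The word `I₁(I₂I₁)^k` is the reflection with polar vector `u + (μ-kκ)e`, so non-ellipticity of
`w_A^{(k)}` yields `|μ-kκ| ≥ 1` (`one_le_norm_of_not_isElliptic`). Now `|μ+xκ|² - 1` is a quadratic
in `x`, known at `0` and `1` and nonnegative at `-k`. The hypotheses on `r₁, r₂` are what makes it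
nonnegative at all integers with leading coefficient at least `1` (`quadratic_nonneg`). -/

theorem herm_add_left (x y z : Fin 3 → ℂ) : herm (x + y) z = herm x z + herm y z := by
  simp [herm]; ring

theorem herm_sub_left (x y z : Fin 3 → ℂ) : herm (x - y) z = herm x z - herm y z := by
  simp [herm]; ring

theorem herm_neg_left (x z : Fin 3 → ℂ) : herm (-x) z = -herm x z := by
  simp [herm]; ring

theorem herm_smul_left (a : ℂ) (x z : Fin 3 → ℂ) : herm (a • x) z = a * herm x z := by
  simp [herm]; ring

theorem conj_herm (x y : Fin 3 → ℂ) : conj (herm x y) = herm y x := by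
  simp [herm]; ring

theorem herm_add_right (x y z : Fin 3 → ℂ) : herm x (y + z) = herm x y + herm x z := by
  simp [herm]; ring

theorem herm_sub_right (x y z : Fin 3 → ℂ) : herm x (y - z) = herm x y - herm x z := by
  simp [herm]; ring

theorem herm_neg_right (x z : Fin 3 → ℂ) : herm x (-z) = -herm x z := by
  simp [herm]; ring

theorem herm_smul_right (a : ℂ) (x z : Fin 3 → ℂ) : herm x (a • z) = conj a * herm x z := by
  simp [herm]; ring

theorem herm_eq_zero_comm {x y : Fin 3 → ℂ} (h : herm x y = 0) : herm y x = 0 := by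
  rw [← conj_herm, h, map_zero]

theorem norm_herm_comm (x y : Fin 3 → ℂ) : ‖herm x y‖ = ‖herm y x‖ := by
  rw [← conj_herm, Complex.norm_conj]

theorem hnorm_smul (a : ℂ) (z : Fin 3 → ℂ) : hnorm (a • z) = ‖a‖ ^ 2 * hnorm z := by
  simp [hnorm, herm, Complex.sq_norm, Complex.normSq_apply]; ring

theorem hnorm_add_smul (z : Fin 3 → ℂ) (a : ℂ) (c : Fin 3 → ℂ) :
    hnorm (z + a • c) = hnorm z + 2 * (conj a * herm z c).re + ‖a‖ ^ 2 * hnorm c := by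
  simp [hnorm, herm, Complex.sq_norm, Complex.normSq_apply]; ring

theorem hnorm_eq_of_herm {z : Fin 3 → ℂ} {r : ℝ} (h : herm z z = r) : hnorm z = r := by
  simp [hnorm, h]

theorem continuous_herm_left (w : Fin 3 → ℂ) : Continuous fun z => herm z w := by
  unfold herm; fun_prop

theorem continuous_hnorm : Continuous hnorm := by
  unfold hnorm herm; fun_prop

/-- The component of `z` orthogonal to `c`. -/
noncomputable def perp (c z : Fin 3 → ℂ) : Fin 3 → ℂ := z - (herm z c / herm c c) • c

theorem herm_perp_left {c : Fin 3 → ℂ} (hc : hnorm c ≠ 0) (z : Fin 3 → ℂ) :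
    herm (perp c z) c = 0 := by
  have : herm c c ≠ 0 := by rw [herm_self]; exact_mod_cast hc
  rw [perp, herm_sub_left, herm_smul_left, div_mul_cancel₀ _ this, sub_self]

theorem herm_perp_of_orth {c q : Fin 3 → ℂ} (hq : herm q c = 0) (z : Fin 3 → ℂ) :
    herm q (perp c z) = herm q z := by
  rw [perp, herm_sub_right, herm_smul_right, hq, mul_zero, sub_zero]

theorem hnorm_perp {c : Fin 3 → ℂ} (hc : hnorm c ≠ 0) (z : Fin 3 → ℂ) :
    hnorm (perp c z) = hnorm z - ‖herm z c‖ ^ 2 / hnorm c := by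
  have h : herm c c ≠ 0 := by rw [herm_self]; exact_mod_cast hc
  apply hnorm_eq_of_herm
  rw [herm_perp_of_orth (herm_perp_left hc z), perp, herm_sub_left, herm_smul_left,
    ← conj_herm z c, herm_self, herm_self]
  push_cast
  rw [← Complex.mul_conj']
  ring

/-- The orthogonal complement of a negative vector is positive definite. -/
theorem hnorm_pos_of_orth {y z : Fin 3 → ℂ} (hz : hnorm z < 0) (hy : herm y z = 0)
    (hy0 : y ≠ 0) : 0 < hnorm y := by
  have hz2 : z 2 ≠ 0 := by
    intro h
    have : hnorm z = ‖z 1‖ ^ 2 := by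
      simp [hnorm, herm, h, Complex.sq_norm, Complex.normSq_apply]
    nlinarith [sq_nonneg ‖z 1‖]
  set a := z 0 / z 2 with ha
  set b := z 1 / z 2 with hb
  have h0 : z 0 = a * z 2 := by rw [ha]; field_simp
  have h1 : z 1 = b * z 2 := by rw [hb]; field_simp
  have hzn : hnorm z = ‖z 2‖ ^ 2 * (2 * a.re + ‖b‖ ^ 2) := by
    simp [hnorm, herm, h0, h1, Complex.sq_norm, Complex.normSq_apply]; ring
  have hab : 2 * a.re + ‖b‖ ^ 2 < 0 := by
    by_contra hcon
    have := mul_nonneg (sq_nonneg ‖z 2‖) (not_lt.1 hcon)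
    linarith
  have hy0' : y 0 = -(y 1 * conj b) - y 2 * conj a := by
    have : (y 0 + y 1 * conj b + y 2 * conj a) * conj (z 2) = 0 := by
      rw [← hy]; simp [herm, h0, h1]; ring
    have hz2' : conj (z 2) ≠ 0 := by simpa using hz2
    have := (mul_eq_zero.1 this).resolve_right hz2'
    linear_combination this
  -- Completing the square in `y 1`; the last bracket has the sign of `-⟨z,z⟩`.
  have key : hnorm y = ‖y 1 - b * y 2‖ ^ 2 + ‖y 2‖ ^ 2 * -(2 * a.re + ‖b‖ ^ 2) := by
    simp [hnorm, herm, hy0', Complex.sq_norm, Complex.normSq_apply]; ring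
  rw [key]
  by_cases hy2 : y 2 = 0
  · have hy1 : y 1 ≠ 0 := by
      intro hy1
      apply hy0
      funext i
      fin_cases i <;> simp [hy0', hy1, hy2]
    have := pow_pos (norm_pos_iff.2 hy1) 2
    simp only [hy2, mul_zero, sub_zero, norm_zero]
    linarith
  · have := norm_pos_iff.2 hy2
    have h' : 0 < -(2 * a.re + ‖b‖ ^ 2) := by linarith
    positivity

theorem hnorm_nonneg_of_orth {y z : Fin 3 → ℂ} (hz : hnorm z < 0) (hy : herm y z = 0) :
    0 ≤ hnorm y := by
  by_cases h : y = 0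
  · simp [h, hnorm, herm]
  · exact (hnorm_pos_of_orth hz hy h).le

/-- The reversed Cauchy-Schwarz inequality for a negative vector. -/
theorem hnorm_mul_hnorm_le {p : Fin 3 → ℂ} (hp : hnorm p < 0) (v : Fin 3 → ℂ) :
    hnorm v * hnorm p ≤ ‖herm v p‖ ^ 2 := by
  have h := hnorm_nonneg_of_orth hp (herm_perp_left hp.ne v)
  rw [hnorm_perp hp.ne, sub_nonneg, div_le_iff_of_neg hp] at h
  exact h

/-- A vector orthogonal to two given ones. -/
noncomputable def cross (c d : Fin 3 → ℂ) : Fin 3 → ℂ :=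
  ![conj (c 0 * d 1 - c 1 * d 0), conj (c 2 * d 0 - c 0 * d 2), conj (c 1 * d 2 - c 2 * d 1)]

theorem herm_cross_left (c d : Fin 3 → ℂ) : herm (cross c d) c = 0 := by
  simp [herm, cross]; ring

theorem herm_cross_right (c d : Fin 3 → ℂ) : herm (cross c d) d = 0 := by
  simp [herm, cross]; ring

theorem hnorm_cross (c d : Fin 3 → ℂ) :
    hnorm (cross c d) = ‖herm c d‖ ^ 2 - hnorm c * hnorm d := by
  simp [hnorm, herm, cross, Complex.sq_norm, Complex.normSq_apply]; ring

theorem exists_neg_orth {d : Fin 3 → ℂ} (hd : 0 < hnorm d) :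
    ∃ v, hnorm v < 0 ∧ herm v d = 0 := by
  refine ⟨perp d ![1, 0, -1], ?_, herm_perp_left hd.ne' _⟩
  rw [hnorm_perp hd.ne']
  have : hnorm ![1, 0, -1] = -2 := by simp [hnorm, herm]; norm_num
  rw [this]
  have : 0 ≤ ‖herm ![1, 0, -1] d‖ ^ 2 / hnorm d := by positivity
  linarith

/-! ### Points and distances -/

theorem HC2.hnorm_vec (p : HC2) : hnorm p.vec < 0 := p.2

theorem HC2.exists_vec_eq {z : Fin 3 → ℂ} (hz : hnorm z < 0) :
    ∃ (p : HC2) (a : ℂ), a ≠ 0 ∧ p.vec = a • z := by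
  have hz0 : z ≠ 0 := by
    rintro rfl
    simp [hnorm, herm] at hz
  obtain ⟨a, ha⟩ := Projectivization.exists_smul_eq_mk_rep ℂ z hz0
  have ha' : (Projectivization.mk ℂ z hz0).rep = (a : ℂ) • z := ha.symm
  refine ⟨⟨Projectivization.mk ℂ z hz0, ?_⟩, a, a.ne_zero, ha'⟩
  rw [ha', hnorm_smul]
  have := norm_pos_iff.2 a.ne_zero
  nlinarith [pow_pos this 2]

theorem bergmanDist_eq (p q : HC2) : bergmanDist p q =
    2 * Real.arcosh (Real.sqrt (‖herm p.vec q.vec‖ ^ 2 / (hnorm p.vec * hnorm q.vec))) := by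
  rw [bergmanDist, ← conj_herm p.vec q.vec, Complex.mul_conj', ← Complex.ofReal_pow,
    Complex.ofReal_re]

theorem one_le_ratio (p q : HC2) :
    1 ≤ ‖herm p.vec q.vec‖ ^ 2 / (hnorm p.vec * hnorm q.vec) := by
  rw [one_le_div (mul_pos_of_neg_of_neg p.hnorm_vec q.hnorm_vec)]
  exact hnorm_mul_hnorm_le q.hnorm_vec _

theorem bergmanDist_nonneg (p q : HC2) : 0 ≤ bergmanDist p q := by
  rw [bergmanDist_eq]
  have := Real.arcosh_nonneg (Real.one_le_sqrt.2 (one_le_ratio p q))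
  linarith

theorem cosh_bergmanDist_sq (p q : HC2) : Real.cosh (bergmanDist p q / 2) ^ 2 =
    ‖herm p.vec q.vec‖ ^ 2 / (hnorm p.vec * hnorm q.vec) := by
  have h := one_le_ratio p q
  rw [bergmanDist_eq, mul_div_cancel_left₀ _ two_ne_zero,
    Real.cosh_arcosh (Real.one_le_sqrt.2 h), Real.sq_sqrt (by linarith)]

theorem cosh_half_sq_le {a b : ℝ} (ha : 0 ≤ a) (hab : a ≤ b) :
    Real.cosh (a / 2) ^ 2 ≤ Real.cosh (b / 2) ^ 2 := by
  have h : Real.cosh (a / 2) ≤ Real.cosh (b / 2) := by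
    rw [Real.cosh_le_cosh, abs_of_nonneg (by linarith), abs_of_nonneg (by linarith)]
    linarith
  have := Real.cosh_pos (a / 2)
  gcongr

/-- A lower bound for the distance between points of two complex geodesics. -/
theorem le_cosh_bergmanDist_sq (c d : PolarVector) {p q : HC2} (hp : p ∈ geodesic c)
    (hq : q ∈ geodesic d) :
    ‖herm c.1 d.1‖ ^ 2 / (hnorm c.1 * hnorm d.1) ≤ Real.cosh (bergmanDist p q / 2) ^ 2 := by
  have hc := c.2
  have hd := d.2
  have hpn := p.hnorm_vec
  have hqn := q.hnorm_vec
  rw [cosh_bergmanDist_sq]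
  have hp' : herm p.vec c.1 = 0 := hp
  have hq' : herm q.vec d.1 = 0 := hq
  -- The reversed Cauchy-Schwarz inequality is used twice: for `p` against the projection of `q` to
  -- `c`, then for `q` against the projection of `c` orthogonal to `d`.
  have h1 := hnorm_mul_hnorm_le hpn (perp c.1 q.vec)
  rw [norm_herm_comm, herm_perp_of_orth hp', hnorm_perp hc.ne'] at h1
  have h2 := hnorm_mul_hnorm_le hqn (perp d.1 c.1)
  rw [norm_herm_comm, herm_perp_of_orth hq', hnorm_perp hd.ne'] at h2
  rw [le_div_iff₀ (mul_pos_of_neg_of_neg hpn hqn)]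
  refine le_trans ?_ h1
  have h3 : (hnorm q.vec - ‖herm q.vec c.1‖ ^ 2 / hnorm c.1) ≤
      ‖herm c.1 d.1‖ ^ 2 / (hnorm c.1 * hnorm d.1) * hnorm q.vec := by
    have := div_le_div_of_nonneg_right h2 hc.le
    have e : (hnorm c.1 - ‖herm c.1 d.1‖ ^ 2 / hnorm d.1) * hnorm q.vec / hnorm c.1 =
      hnorm q.vec - ‖herm c.1 d.1‖ ^ 2 / (hnorm c.1 * hnorm d.1) * hnorm q.vec := by
      field_simp
    rw [e] at this
    linarith
  nlinarith [mul_le_mul_of_nonpos_right h3 hpn.le]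

theorem geodesic_nonempty (c : PolarVector) : (geodesic c).Nonempty := by
  obtain ⟨v, hv, hvc⟩ := exists_neg_orth c.2
  obtain ⟨p, a, -, hp⟩ := HC2.exists_vec_eq hv
  refine ⟨p, ?_⟩
  change herm p.vec c.1 = 0
  rw [hp, herm_smul_left, hvc, mul_zero]

theorem le_cosh_setDist_sq (c d : PolarVector)
    (h : 1 ≤ ‖herm c.1 d.1‖ ^ 2 / (hnorm c.1 * hnorm d.1)) :
    ‖herm c.1 d.1‖ ^ 2 / (hnorm c.1 * hnorm d.1) ≤
      Real.cosh (setDist (geodesic c) (geodesic d) / 2) ^ 2 := by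
  set t := ‖herm c.1 d.1‖ ^ 2 / (hnorm c.1 * hnorm d.1)
  have ht : 1 ≤ Real.sqrt t := Real.one_le_sqrt.2 h
  have h0 := Real.arcosh_nonneg ht
  have hle : 2 * Real.arcosh (Real.sqrt t) ≤ setDist (geodesic c) (geodesic d) := by
    refine le_csInf ((geodesic_nonempty c).image2 (geodesic_nonempty d)) ?_
    rintro _ ⟨p, hp, q, hq, rfl⟩
    have h1 := le_cosh_bergmanDist_sq c d hp hq
    by_contra hcon
    have h2 : bergmanDist p q / 2 < Real.arcosh (Real.sqrt t) := by linarith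
    have h3 : Real.cosh (bergmanDist p q / 2) < Real.cosh (Real.arcosh (Real.sqrt t)) := by
      rw [Real.cosh_lt_cosh, abs_of_nonneg (by linarith [bergmanDist_nonneg p q]),
        abs_of_nonneg h0]
      exact h2
    rw [Real.cosh_arcosh ht] at h3
    have h4 : Real.cosh (bergmanDist p q / 2) ^ 2 < Real.sqrt t ^ 2 := by
      have := Real.cosh_pos (bergmanDist p q / 2)
      gcongr
    rw [Real.sq_sqrt (by linarith)] at h4
    linarith
  have := cosh_half_sq_le (by linarith) hle
  rwa [mul_div_cancel_left₀ _ two_ne_zero, Real.cosh_arcosh ht, Real.sq_sqrt (by linarith)]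
    at this

theorem setDist_nonneg (C D : Set HC2) : 0 ≤ setDist C D := by
  apply Real.sInf_nonneg
  rintro _ ⟨p, -, q, -, rfl⟩
  exact bergmanDist_nonneg p q

/-- The right side is `cosh²` of half the distance from `q` to its orthogonal projection on `c`, so
each point of `d` bounds the infimum from above. -/
theorem cosh_setDist_sq_le (c d : PolarVector) {q : Fin 3 → ℂ} (hq : hnorm q < 0)
    (hqd : herm q d.1 = 0) :
    Real.cosh (setDist (geodesic c) (geodesic d) / 2) ^ 2 ≤
      1 + ‖herm q c.1‖ ^ 2 / (hnorm c.1 * -hnorm q) := by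
  have hc := c.2
  have hn := hnorm_perp hc.ne' q
  have hpneg : hnorm (perp c.1 q) < 0 := by
    rw [hn]
    have : 0 ≤ ‖herm q c.1‖ ^ 2 / hnorm c.1 := by positivity
    linarith
  obtain ⟨P, a, ha, hP⟩ := HC2.exists_vec_eq hpneg
  obtain ⟨Q, b, hb, hQ⟩ := HC2.exists_vec_eq hq
  have hPc : P ∈ geodesic c := by
    change herm P.vec c.1 = 0
    rw [hP, herm_smul_left, herm_perp_left hc.ne', mul_zero]
  have hQd : Q ∈ geodesic d := by
    change herm Q.vec d.1 = 0
    rw [hQ, herm_smul_left, hqd, mul_zero]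
  have hle : setDist (geodesic c) (geodesic d) ≤ bergmanDist P Q := by
    refine csInf_le ⟨0, ?_⟩ ⟨P, hPc, Q, hQd, rfl⟩
    rintro _ ⟨p, -, q, -, rfl⟩
    exact bergmanDist_nonneg p q
  refine (cosh_half_sq_le (setDist_nonneg _ _) hle).trans (le_of_eq ?_)
  rw [cosh_bergmanDist_sq, hP, hQ, hnorm_smul, hnorm_smul, herm_smul_left, herm_smul_right,
    norm_mul, norm_mul, Complex.norm_conj]
  have h1 : herm (perp c.1 q) q = hnorm (perp c.1 q) := by
    rw [← herm_self, herm_perp_of_orth (herm_perp_left hc.ne' q)]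
  rw [h1, Complex.norm_real, Real.norm_eq_abs, mul_pow, mul_pow, sq_abs]
  have ha' : ‖a‖ ≠ 0 := norm_ne_zero_iff.2 ha
  have hb' : ‖b‖ ≠ 0 := norm_ne_zero_iff.2 hb
  have e : ‖a‖ ^ 2 * (‖b‖ ^ 2 * hnorm (perp c.1 q) ^ 2) /
      (‖a‖ ^ 2 * hnorm (perp c.1 q) * (‖b‖ ^ 2 * hnorm q)) = hnorm (perp c.1 q) / hnorm q := by
    field_simp [hpneg.ne, hq.ne]
  rw [e, hn]
  field_simp [hq.ne, hc.ne']
  ring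

/-- Otherwise the vector orthogonal to both polar vectors is negative, hence a common point. -/
theorem one_le_ratio_of_disjoint (c d : PolarVector)
    (h : Disjoint (geodesic c) (geodesic d)) :
    1 ≤ ‖herm c.1 d.1‖ ^ 2 / (hnorm c.1 * hnorm d.1) := by
  rw [one_le_div (mul_pos c.2 d.2)]
  by_contra hcon
  have hneg : hnorm (cross c.1 d.1) < 0 := by rw [hnorm_cross]; linarith
  obtain ⟨p, a, -, hp⟩ := HC2.exists_vec_eq hneg
  have hpc : p ∈ geodesic c := by
    change herm p.vec c.1 = 0
    rw [hp, herm_smul_left, herm_cross_left, mul_zero]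
  have hpd : p ∈ geodesic d := by
    change herm p.vec d.1 = 0
    rw [hp, herm_smul_left, herm_cross_right, mul_zero]
  exact Set.disjoint_left.1 h hpc hpd

theorem perp_ne_zero_of_disjoint (c d : PolarVector)
    (h : Disjoint (geodesic c) (geodesic d)) : perp d.1 c.1 ≠ 0 := by
  intro h0
  have hcd : c.1 = (herm c.1 d.1 / herm d.1 d.1) • d.1 := sub_eq_zero.1 h0
  obtain ⟨p, hp⟩ := geodesic_nonempty d
  have hpc : p ∈ geodesic c := by
    change herm p.vec c.1 = 0
    have hp' : herm p.vec d.1 = 0 := hp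
    rw [hcd, herm_smul_right, hp', mul_zero]
  exact Set.disjoint_left.1 h hpc hp

/-- The distance between two disjoint complex geodesics in terms of their polar vectors. -/
theorem cosh_setDist_sq (c d : PolarVector) (h : Disjoint (geodesic c) (geodesic d)) :
    Real.cosh (setDist (geodesic c) (geodesic d) / 2) ^ 2 =
      ‖herm c.1 d.1‖ ^ 2 / (hnorm c.1 * hnorm d.1) := by
  have hc := c.2
  have hd := d.2
  have ht := one_le_ratio_of_disjoint c d h
  refine le_antisymm ?_ (le_cosh_setDist_sq c d ht)
  set w := perp d.1 c.1 with hw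
  have hw0 : w ≠ 0 := perp_ne_zero_of_disjoint c d h
  have hwd : herm w d.1 = 0 := herm_perp_left hd.ne' _
  have hwn : hnorm w = hnorm c.1 * (1 - ‖herm c.1 d.1‖ ^ 2 / (hnorm c.1 * hnorm d.1)) := by
    rw [hw, hnorm_perp hd.ne']; field_simp
  have hzc : ∀ z, herm z d.1 = 0 → herm z c.1 = herm z w := fun z hz =>
    (herm_perp_of_orth hz _).symm
  rcases ht.lt_or_eq with ht | ht
  -- Ultraparallel case: `w` is the foot on `d` of the common perpendicular, and the infimum is
  -- attained there.
  · have hneg : hnorm w < 0 := by rw [hwn]; exact mul_neg_of_pos_of_neg hc (by linarith)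
    refine (cosh_setDist_sq_le c d hneg hwd).trans (le_of_eq ?_)
    rw [hzc w hwd, herm_self, Complex.norm_real, Real.norm_eq_abs, sq_abs]
    have : hnorm w ^ 2 / (hnorm c.1 * -hnorm w) = -hnorm w / hnorm c.1 := by
      field_simp [hneg.ne]
    rw [this, hwn]
    field_simp
    ring
  · rw [← ht]
    have hwn0 : hnorm w = 0 := by rw [hwn, ← ht]; ring
    obtain ⟨v, hv, hvd⟩ := exists_neg_orth hd
    have hvw : herm w v ≠ 0 := by
      intro h0
      have := hnorm_pos_of_orth hv h0 hw0
      linarith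
    refine le_of_forall_pos_le_add fun ε hε => ?_
    -- Asymptotic case: `w` is the common ideal point, and `w + a • v` is a point of `d` close to
    -- it. Since `⟨q,c⟩ = -s` and `-⟨q,q⟩ ≥ 2s`, the excess over `1` is at most `s / (2⟨c,c⟩) = ε`.
    set s : ℝ := 2 * hnorm c.1 * ε with hs
    have hspos : 0 < s := by positivity
    set a : ℂ := -s / conj (herm w v) with ha
    have hvw' : conj (herm w v) ≠ 0 := by simpa using hvw
    have h1 : conj a * herm w v = -s := by
      rw [ha]; simp; field_simp
    have hvw2 : herm v w ≠ 0 := by rwa [← conj_herm]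
    have hqn : hnorm (w + a • v) ≤ -2 * s := by
      rw [hnorm_add_smul, hwn0, h1]
      have : ‖a‖ ^ 2 * hnorm v ≤ 0 := mul_nonpos_of_nonneg_of_nonpos (by positivity) hv.le
      simp
      linarith
    have hqd : herm (w + a • v) d.1 = 0 := by
      rw [herm_add_left, herm_smul_left, hwd, hvd]; simp
    have hqc : herm (w + a • v) c.1 = -s := by
      rw [hzc _ hqd, herm_add_left, herm_smul_left, herm_self, hwn0, ha, conj_herm]
      simp only [Complex.ofReal_zero, zero_add]
      field_simp
    refine (cosh_setDist_sq_le c d (by linarith) hqd).trans ?_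
    rw [hqc, norm_neg, Complex.norm_real, Real.norm_eq_abs, sq_abs]
    gcongr
    rw [div_le_iff₀ (mul_pos hc (by linarith))]
    have : hnorm c.1 * (2 * s) ≤ hnorm c.1 * -hnorm (w + a • v) :=
      mul_le_mul_of_nonneg_left (by linarith) hc.le
    nlinarith [mul_le_mul_of_nonneg_left this hε.le]

/-! ### A frame adapted to an ideal vertex and the opposite side -/

/-- `e` is a null vector (the ideal vertex), `v` is a unit polar vector and `u` is a unit vector
orthogonal to both. -/
structure IsFrame (e u v : Fin 3 → ℂ) : Prop where
  ee : herm e e = 0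
  uu : herm u u = 1
  vv : herm v v = 1
  eu : herm e u = 0
  ev : herm e v = 1
  uv : herm u v = 0

namespace IsFrame

variable {e u v : Fin 3 → ℂ}

theorem ue (F : IsFrame e u v) : herm u e = 0 := herm_eq_zero_comm F.eu

theorem vu (F : IsFrame e u v) : herm v u = 0 := herm_eq_zero_comm F.uv

theorem ve (F : IsFrame e u v) : herm v e = 1 := by rw [← conj_herm, F.ev, map_one]

theorem hnorm_center (F : IsFrame e u v) : hnorm (v - e) = -1 := by
  apply hnorm_eq_of_herm
  simp only [herm_sub_left, herm_sub_right, F.vv, F.ev, F.ve, F.ee]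
  push_cast
  ring

/-- The second factor is `|⟨z, 2v - e⟩|`, where `2v - e` is the image of the null vector `e` under
the third reflection. The inequality expresses `⟨z,z⟩ < 0` in the basis `u, e, 2v - e`. It forces
that reflection to exchange the outside of the unit disc with the inside. -/
theorem norm_sq_lt (F : IsFrame e u v) {z : Fin 3 → ℂ} (hz : hnorm z < 0) :
    ‖herm z u‖ ^ 2 < ‖herm z e‖ * ‖-herm z e + 2 * herm z v‖ := by
  set x := herm z u with hx
  set y := herm z e with hy
  set y' := -y + 2 * herm z v with hy'
  -- The remainder of `z` after its components along `u`, `e` and `2v - e`; the halves come from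
  -- `⟨e, 2v - e⟩ = 2`. It is orthogonal to the negative vector `v - e`, so its norm is nonnegative.
  set w := z - x • u - (y' / 2) • e - (y / 2) • ((2 : ℂ) • v - e) with hw
  have hwu : herm w u = 0 := by
    rw [hw]
    simp only [herm_sub_left, herm_smul_left, F.uu, F.eu, F.vu, ← hx]
    ring
  have hwe : herm w e = 0 := by
    rw [hw]
    simp only [herm_sub_left, herm_smul_left, F.ue, F.ee, F.ve, ← hy]
    ring
  have hwv : herm w v = 0 := by
    rw [hw]
    simp only [herm_sub_left, herm_smul_left, F.uv, F.ev, F.vv]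
    rw [hy']
    ring
  have hw0 : 0 ≤ hnorm w := by
    refine hnorm_nonneg_of_orth (z := v - e) (by rw [F.hnorm_center]; norm_num) ?_
    rw [herm_sub_right, hwv, hwe, sub_zero]
  have hww : (hnorm w : ℂ) = hnorm z - x * conj x - y' * conj y / 2 - y * conj y' / 2 := by
    have hwz : herm w w = herm w z := by
      conv_lhs => rw [hw]
      simp only [herm_sub_right, herm_smul_right]
      rw [← hw, hwu, hwe, hwv]
      ring
    rw [← herm_self, hwz, ← herm_self, hw]
    simp only [herm_sub_left, herm_smul_left]
    rw [← conj_herm z u, ← conj_herm z e, ← conj_herm z v, ← hx, ← hy, hy']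
    simp only [map_add, map_neg, map_mul, Complex.conj_ofNat]
    ring
  have hre := congrArg Complex.re hww
  have h1 : (y' * conj y / 2 + y * conj y' / 2).re = (y * conj y').re := by
    simp; ring
  have h2 : (x * conj x).re = ‖x‖ ^ 2 := by
    rw [Complex.mul_conj']; norm_cast
  have h3 : -(‖y‖ * ‖y'‖) ≤ (y * conj y').re := by
    have := (abs_le.1 (Complex.abs_re_le_norm (y * conj y'))).1
    rwa [norm_mul, Complex.norm_conj] at this
  simp only [Complex.sub_re, Complex.ofReal_re] at hre
  simp only [Complex.add_re] at h1
  linarith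

theorem herm_line (F : IsFrame e u v) (μ ν : ℂ) : herm (u + μ • e) (u + ν • e) = 1 := by
  simp only [herm_add_left, herm_add_right, herm_smul_left, herm_smul_right, F.uu, F.ue, F.eu,
    F.ee]
  ring

theorem inversion_line (F : IsFrame e u v) (μ : ℂ) (z : Fin 3 → ℂ) :
    inversionMatrix (u + μ • e) *ᵥ z =
      -z + (2 * (herm z u + conj μ * herm z e)) • (u + μ • e) := by
  rw [inversionMatrix_mulVec, F.herm_line, herm_add_right, herm_smul_right, div_one]

/-- With the sign change of `⟨z,e⟩`, this says that `ξ = ⟨z,u⟩/⟨z,e⟩` undergoes the half-turn `ξ ↦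
-ξ - 2 conj μ`. -/
theorem herm_inversion_line_u (F : IsFrame e u v) (μ : ℂ) (z : Fin 3 → ℂ) :
    herm (inversionMatrix (u + μ • e) *ᵥ z) u = herm z u + 2 * conj μ * herm z e := by
  rw [F.inversion_line]
  simp only [herm_add_left, herm_neg_left, herm_smul_left, F.uu, F.eu]
  ring

theorem herm_inversion_line_e (F : IsFrame e u v) (μ : ℂ) (z : Fin 3 → ℂ) :
    herm (inversionMatrix (u + μ • e) *ᵥ z) e = -herm z e := by
  rw [F.inversion_line]
  simp only [herm_add_left, herm_neg_left, herm_smul_left, F.ue, F.ee]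
  ring

theorem inversion_v (F : IsFrame e u v) (z : Fin 3 → ℂ) :
    inversionMatrix v *ᵥ z = -z + (2 * herm z v) • v := by
  rw [inversionMatrix_mulVec, F.vv, div_one]

theorem herm_inversion_v_u (F : IsFrame e u v) (z : Fin 3 → ℂ) :
    herm (inversionMatrix v *ᵥ z) u = -herm z u := by
  rw [F.inversion_v]
  simp only [herm_add_left, herm_neg_left, herm_smul_left, F.vu]
  ring

theorem herm_inversion_v_e (F : IsFrame e u v) (z : Fin 3 → ℂ) :
    herm (inversionMatrix v *ᵥ z) e = -herm z e + 2 * herm z v := by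
  rw [F.inversion_v]
  simp only [herm_add_left, herm_neg_left, herm_smul_left, F.ve]
  ring

/-- Three reflections in asymptotic geodesics whose polar vectors lie in arithmetic position. -/
theorem inversion_mul_inversion_mul_inversion (F : IsFrame e u v) (μ κ : ℂ) (r s t : ℝ) :
    inversionMatrix (u + (μ + t * κ) • e) * inversionMatrix (u + (μ + s * κ) • e) *
      inversionMatrix (u + (μ + r * κ) • e) =
    inversionMatrix (u + (μ + (t - s + r : ℝ) * κ) • e) := by
  apply Matrix.toLin'.injective
  refine LinearMap.ext fun z => ?_
  rw [Matrix.toLin'_apply, Matrix.toLin'_apply, ← Matrix.mulVec_mulVec, ← Matrix.mulVec_mulVec,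
    F.inversion_line (μ + t * κ), F.herm_inversion_line_u, F.herm_inversion_line_e,
    F.herm_inversion_line_u, F.herm_inversion_line_e, F.inversion_line (μ + s * κ),
    F.herm_inversion_line_u, F.herm_inversion_line_e, F.inversion_line, F.inversion_line]
  funext i
  simp only [Pi.add_apply, Pi.neg_apply, Pi.smul_apply, smul_eq_mul, map_add, map_mul,
    Complex.conj_ofReal]
  push_cast
  ring

end IsFrame

/-- The three reflections are brought into normal form with respect to a frame. -/
structure IsNormalForm (c : Fin 3 → PolarVector) (e u v : Fin 3 → ℂ) (μ κ : ℂ) : Prop where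
  frame : IsFrame e u v
  inv0 : inversionMatrix (c 0).1 = inversionMatrix (u + μ • e)
  inv1 : inversionMatrix (c 1).1 = inversionMatrix (u + (μ + κ) • e)
  inv2 : inversionMatrix (c 2).1 = inversionMatrix v

/-! ### Positions of points -/

/-- Points over the unit disc. -/
def Inner (x y : ℂ) : Prop := ‖x‖ < ‖y‖

/-- Points over the images of the unit disc under the elements of the dihedral group whose reduced
word starts with the first generator. -/
def OuterZero (M K x y : ℂ) : Prop := ∃ n : ℤ,
  (n ≤ 0 ∧ ‖x + 2 * (M + n * K) * y‖ < ‖y‖) ∨ (n < 0 ∧ ‖x + 2 * (n * K) * y‖ < ‖y‖)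

/-- Points over the images of the unit disc under the elements of the dihedral group whose reduced
word starts with the second generator. -/
def OuterOne (M K x y : ℂ) : Prop := ∃ n : ℤ,
  (1 ≤ n ∧ ‖x + 2 * (M + n * K) * y‖ < ‖y‖) ∨ (0 < n ∧ ‖x + 2 * (n * K) * y‖ < ‖y‖)

theorem outerZero_of_inner {M K x y : ℂ} (h : Inner x y) :
    OuterZero M K (x + 2 * M * y) (-y) := by
  refine ⟨0, Or.inl ⟨le_rfl, ?_⟩⟩
  rw [norm_neg]
  unfold Inner at h
  convert h using 2
  push_cast; ring

theorem outerZero_of_outerOne {M K x y : ℂ} (h : OuterOne M K x y) :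
    OuterZero M K (x + 2 * M * y) (-y) := by
  obtain ⟨n, ⟨hn, h⟩ | ⟨hn, h⟩⟩ := h
  · refine ⟨-n, Or.inr ⟨by omega, ?_⟩⟩
    rw [norm_neg]
    convert h using 2
    push_cast; ring
  · refine ⟨-n, Or.inl ⟨by omega, ?_⟩⟩
    rw [norm_neg]
    convert h using 2
    push_cast; ring

theorem outerOne_of_inner {M K x y : ℂ} (h : Inner x y) :
    OuterOne M K (x + 2 * (M + K) * y) (-y) := by
  refine ⟨1, Or.inl ⟨le_rfl, ?_⟩⟩
  rw [norm_neg]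
  unfold Inner at h
  convert h using 2
  push_cast; ring

theorem outerOne_of_outerZero {M K x y : ℂ} (h : OuterZero M K x y) :
    OuterOne M K (x + 2 * (M + K) * y) (-y) := by
  obtain ⟨n, ⟨hn, h⟩ | ⟨hn, h⟩⟩ := h
  · refine ⟨1 - n, Or.inr ⟨by omega, ?_⟩⟩
    rw [norm_neg]
    convert h using 2
    push_cast; ring
  · refine ⟨1 - n, Or.inl ⟨by omega, ?_⟩⟩
    rw [norm_neg]
    convert h using 2
    push_cast; ring

/-- For `|a| ≥ 1` the open unit discs about `-2a` and `0` are disjoint. -/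
theorem norm_lt_of_norm_add_lt {x y a : ℂ} (ha : 1 ≤ ‖a‖) (h : ‖x + 2 * a * y‖ < ‖y‖) :
    ‖y‖ < ‖x‖ := by
  have h1 : ‖2 * a * y‖ ≤ ‖x + 2 * a * y‖ + ‖x‖ := by
    have := norm_sub_le (x + 2 * a * y) x
    rwa [add_sub_cancel_left] at this
  rw [norm_mul, norm_mul, Complex.norm_ofNat] at h1
  nlinarith [mul_le_mul_of_nonneg_right ha (norm_nonneg y)]

theorem one_le_norm_intCast_mul {K : ℂ} (hK : 1 ≤ ‖K‖) {n : ℤ} (hn : n ≠ 0) :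
    1 ≤ ‖(n : ℂ) * K‖ := by
  rw [norm_mul, Complex.norm_intCast]
  have : (1 : ℝ) ≤ |(n : ℝ)| := by exact_mod_cast Int.one_le_abs hn
  nlinarith

theorem OuterZero.norm_lt {M K x y : ℂ} (hM : ∀ n : ℤ, 1 ≤ ‖M + n * K‖) (hK : 1 ≤ ‖K‖)
    (h : OuterZero M K x y) : ‖y‖ < ‖x‖ := by
  obtain ⟨n, ⟨hn, h⟩ | ⟨hn, h⟩⟩ := h
  · exact norm_lt_of_norm_add_lt (hM n) h
  · exact norm_lt_of_norm_add_lt (one_le_norm_intCast_mul hK hn.ne) h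

theorem OuterOne.norm_lt {M K x y : ℂ} (hM : ∀ n : ℤ, 1 ≤ ‖M + n * K‖) (hK : 1 ≤ ‖K‖)
    (h : OuterOne M K x y) : ‖y‖ < ‖x‖ := by
  obtain ⟨n, ⟨hn, h⟩ | ⟨hn, h⟩⟩ := h
  · exact norm_lt_of_norm_add_lt (hM n) h
  · exact norm_lt_of_norm_add_lt (one_le_norm_intCast_mul hK hn.ne') h

/-- The position of a point moved by a reduced word with the given first letter. -/
def Position (M K : ℂ) (i : Option (Fin 3)) (x y : ℂ) : Prop :=
  (i = none → x = 0 ∧ Inner x y) ∧ (i = some 0 → OuterZero M K x y) ∧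
    (i = some 1 → OuterOne M K x y) ∧ (i = some 2 → Inner x y)

/-! ### Ping-pong -/

theorem inversionU_mulVec (c : PolarVector) (B : U21) (z : Fin 3 → ℂ) :
    (inversionU c * B).1.1 *ᵥ z = inversionMatrix c.1 *ᵥ (B.1.1 *ᵥ z) := by
  rw [Matrix.mulVec_mulVec]; rfl

theorem hnorm_mulVec (A : U21) (z : Fin 3 → ℂ) : hnorm (A.1.1 *ᵥ z) = hnorm z := by
  rw [hnorm, A.2, hnorm]

theorem of_eq_γ (i : Fin 3) {m : Multiplicative (ZMod 2)} (hm : m ≠ 1) :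
    Monoid.CoprodI.of (M := fun _ : Fin 3 => Multiplicative (ZMod 2)) (i := i) m = γ i := by
  have : ∀ m : Multiplicative (ZMod 2), m ≠ 1 → m = Multiplicative.ofAdd 1 := by decide
  rw [this m hm]; rfl

/-- Ping-pong by induction on the reduced word, tracking the image of the base point `v - e`. A lift
to `U(2,1)` is carried along because the two coordinates are defined only on vectors. -/
theorem exists_lift_position {c : Fin 3 → PolarVector} {e u v : Fin 3 → ℂ} {μ κ : ℂ}
    (N : IsNormalForm c e u v μ κ) (hμ : ∀ n : ℤ, 1 ≤ ‖conj μ + n * conj κ‖)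
    (hκ : 1 ≤ ‖conj κ‖) (ρ : TriangleGroup →* PU21) (hρ : ∀ j, ρ (γ j) = reflection (c j))
    (w : Monoid.CoprodI.Word fun _ : Fin 3 => Multiplicative (ZMod 2)) :
    ∃ A : U21, (A : PU21) = ρ w.prod ∧ Position (conj μ) (conj κ) w.fstIdx
      (herm (A.1.1 *ᵥ (v - e)) u) (herm (A.1.1 *ᵥ (v - e)) e) := by
  have F := N.frame
  induction w using Monoid.CoprodI.Word.consRecOn with
  | empty =>
    refine ⟨1, by simp, ?_⟩
    have : Inner (herm (v - e) u) (herm (v - e) e) := by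
      simp [Inner, herm_sub_left, F.vu, F.eu, F.ve, F.ee]
    refine ⟨fun _ => ⟨?_, ?_⟩, ?_⟩
    · simp [herm_sub_left, F.vu, F.eu]
    · simpa using this
    · simp [Monoid.CoprodI.Word.fstIdx, Monoid.CoprodI.Word.empty]
  | cons i m w h1 h2 ih =>
    obtain ⟨A, hA, hz⟩ := ih
    have hneg : hnorm (A.1.1 *ᵥ (v - e)) < 0 := by
      rw [hnorm_mulVec, F.hnorm_center]; norm_num
    have hm := of_eq_γ i h2
    refine ⟨inversionU (c i) * A, ?_, ?_⟩
    · rw [Monoid.CoprodI.Word.prod_cons, map_mul, hm, hρ, ← hA]; rfl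
    rw [Monoid.CoprodI.Word.fstIdx_cons, inversionU_mulVec]
    generalize A.1.1 *ᵥ (v - e) = z at hz hneg
    generalize w.fstIdx = o at h1 hz
    obtain ⟨hn, hz0, hz1, hz2⟩ := hz
    fin_cases i
    · have : OuterZero (conj μ) (conj κ) (herm z u + 2 * conj μ * herm z e) (-herm z e) := by
        rcases o with _ | o
        · exact outerZero_of_inner (hn rfl).2
        · fin_cases o
          · exact absurd rfl h1
          · exact outerZero_of_outerOne (hz1 rfl)
          · exact outerZero_of_inner (hz2 rfl)
      simp only [Fin.zero_eta, N.inv0, F.herm_inversion_line_u, F.herm_inversion_line_e]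
      simpa [Position] using this
    · have : OuterOne (conj μ) (conj κ) (herm z u + 2 * (conj μ + conj κ) * herm z e)
          (-herm z e) := by
        rcases o with _ | o
        · exact outerOne_of_inner (hn rfl).2
        · fin_cases o
          · exact outerOne_of_outerZero (hz0 rfl)
          · exact absurd rfl h1
          · exact outerOne_of_inner (hz2 rfl)
      simp only [Fin.mk_one, N.inv1, F.herm_inversion_line_u, F.herm_inversion_line_e, map_add]
      simpa [Position] using this
    · have key : ‖herm z e‖ ≤ ‖herm z u‖ → Inner (-herm z u) (-herm z e + 2 * herm z v) := by
        intro hle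
        have := F.norm_sq_lt hneg
        rw [Inner, norm_neg]
        by_contra hcon
        push Not at hcon
        nlinarith [mul_le_mul hle hcon (norm_nonneg _) (norm_nonneg _)]
      have : Inner (-herm z u) (-herm z e + 2 * herm z v) := by
        rcases o with _ | o
        -- The base point lies inside the disc, so `key` does not apply. Its first coordinate
        -- vanishes, and strictness in `norm_sq_lt` keeps the second one nonzero after reflection.
        · have hx := (hn rfl).1
          have hlt := F.norm_sq_lt hneg
          rw [hx, norm_zero] at hlt
          rw [Inner, hx, neg_zero, norm_zero]
          refine (norm_nonneg _).lt_of_ne fun h0 => ?_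
          rw [← h0] at hlt
          simp at hlt
        · fin_cases o
          · exact key ((hz0 rfl).norm_lt hμ hκ).le
          · exact key ((hz1 rfl).norm_lt hμ hκ).le
          · exact absurd rfl h1
      simp only [Fin.reduceFinMk, N.inv2, F.herm_inversion_v_u, F.herm_inversion_v_e]
      simpa [Position] using this


/-- The elements of `U(2,1)` that almost fix the centre of the third side and are away from the
reflection in it. -/
def nearOne (e u v : Fin 3 → ℂ) : Set U21 :=
  {A | ‖herm (A.1.1 *ᵥ (v - e)) u‖ < ‖herm (A.1.1 *ᵥ (v - e)) e‖ ∧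
    ‖herm (inversionMatrix v *ᵥ (A.1.1 *ᵥ (v - e))) u‖ <
      ‖herm (inversionMatrix v *ᵥ (A.1.1 *ᵥ (v - e))) e‖ ∧
    0 < ‖herm (A.1.1 *ᵥ e) (inversionMatrix v *ᵥ e)‖}

theorem isOpen_nearOne (e u v : Fin 3 → ℂ) : IsOpen (nearOne e u v) := by
  have hval : Continuous fun A : U21 => A.1.1 := Units.continuous_val.comp continuous_subtype_val
  have h1 : ∀ z, Continuous fun A : U21 => A.1.1 *ᵥ z := fun z =>
    hval.matrix_mulVec continuous_const
  have h2 : ∀ z, Continuous fun A : U21 => inversionMatrix v *ᵥ (A.1.1 *ᵥ z) := fun z =>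
    continuous_const.matrix_mulVec (h1 z)
  refine (isOpen_lt ?_ ?_).and ((isOpen_lt ?_ ?_).and (isOpen_lt ?_ ?_))
  · exact ((continuous_herm_left _).comp (h1 _)).norm
  · exact ((continuous_herm_left _).comp (h1 _)).norm
  · exact ((continuous_herm_left _).comp (h2 _)).norm
  · exact ((continuous_herm_left _).comp (h2 _)).norm
  · exact continuous_const
  · exact ((continuous_herm_left _).comp (h1 _)).norm

theorem one_mem_nearOne {e u v : Fin 3 → ℂ} (F : IsFrame e u v) : 1 ∈ nearOne e u v := by
  have h1 : ((1 : U21).1.1 : Matrix (Fin 3) (Fin 3) ℂ) = 1 := rfl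
  simp only [nearOne, Set.mem_ofPred_eq, h1, Matrix.one_mulVec, F.inversion_v]
  simp [herm_sub_left, herm_add_right, herm_neg_right, herm_smul_right, F.vu, F.eu, F.ve, F.ee,
    F.ev, F.vv]

/-- Lifts to `U(2,1)` of the same isometry differ by a nonzero scalar. -/
theorem exists_smul_of_coe_eq {A B : U21} (h : (A : PU21) = (B : PU21)) :
    ∃ a : ℂ, a ≠ 0 ∧ ∀ z, B.1.1 *ᵥ z = a • (A.1.1 *ᵥ z) := by
  obtain ⟨a, ha⟩ := (QuotientGroup.eq.1 h : A⁻¹ * B ∈ scalars)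
  have hB : B.1.1 = a • A.1.1 := by
    have : B = A * (A⁻¹ * B) := by group
    have h2 : B.1.1 = A.1.1 * (A⁻¹ * B).1.1 := congrArg (fun C : U21 => C.1.1) this
    rw [h2, ha]
    simp
  refine ⟨a, ?_, fun z => by rw [hB, Matrix.smul_mulVec]⟩
  rintro rfl
  rw [zero_smul] at hB
  have := B.1.val_inv
  rw [hB, zero_mul] at this
  exact zero_ne_one this

/-- A reduced word starting with one of the first two generators moves the base point out of the
disc, against the first condition of `nearOne`. If it starts with the third, that letter is
stripped: what remains either starts with one of the other two, against the second condition, or is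
empty, against the third. -/
theorem eq_one_of_mem_nearOne {c : Fin 3 → PolarVector} {e u v : Fin 3 → ℂ} {μ κ : ℂ}
    (N : IsNormalForm c e u v μ κ) (hμ : ∀ n : ℤ, 1 ≤ ‖conj μ + n * conj κ‖)
    (hκ : 1 ≤ ‖conj κ‖) (ρ : TriangleGroup →* PU21) (hρ : ∀ j, ρ (γ j) = reflection (c j))
    (g : TriangleGroup) {B : U21} (hB : B ∈ nearOne e u v) (hBg : (B : PU21) = ρ g) : g = 1 := by
  have F := N.frame
  obtain ⟨w, rfl⟩ : ∃ w : Monoid.CoprodI.Word fun _ : Fin 3 => Multiplicative (ZMod 2),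
      w.prod = g := ⟨Monoid.CoprodI.Word.equiv g, Monoid.CoprodI.Word.equiv.left_inv g⟩
  have houter : ∀ w : Monoid.CoprodI.Word fun _ : Fin 3 => Multiplicative (ZMod 2),
      w.fstIdx = some 0 ∨ w.fstIdx = some 1 → ∀ A : U21, (A : PU21) = ρ w.prod →
        ‖herm (A.1.1 *ᵥ (v - e)) u‖ < ‖herm (A.1.1 *ᵥ (v - e)) e‖ → False := by
    intro w hw A hA hlt
    obtain ⟨A', hA', hz⟩ := exists_lift_position N hμ hκ ρ hρ w
    obtain ⟨a, ha, hAB⟩ := exists_smul_of_coe_eq (hA'.trans hA.symm)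
    have ha' : 0 < ‖a‖ := norm_pos_iff.2 ha
    rw [hAB, herm_smul_left, herm_smul_left, norm_mul, norm_mul,
      mul_lt_mul_iff_right₀ ha'] at hlt
    rcases hw with hw | hw
    · exact lt_asymm hlt ((hz.2.1 hw).norm_lt hμ hκ)
    · exact lt_asymm hlt ((hz.2.2.1 hw).norm_lt hμ hκ)
  have hhead : ∀ o : Option (Fin 3), o = none ∨ (o = some 0 ∨ o = some 1) ∨ o = some 2 := by
    decide
  rcases hhead w.fstIdx with h | h | h
  · induction w using Monoid.CoprodI.Word.consRecOn with
    | empty => simp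
    | cons i m w h1 h2 _ => simp at h
  · exact (houter w h B hBg hB.1).elim
  · induction w using Monoid.CoprodI.Word.consRecOn with
    | empty => simp
    | cons i m w h1 h2 _ =>
      rw [Monoid.CoprodI.Word.fstIdx_cons] at h
      obtain rfl : i = 2 := Option.some.inj h
      have hm := of_eq_γ 2 h2
      have hsq : reflection (c 2) * reflection (c 2) = 1 := by
        have : inversionU (c 2) * inversionU (c 2) = 1 := by
          apply Subtype.ext
          apply Units.ext
          exact inversionMatrix_sq (by rw [herm_self]; exact_mod_cast (c 2).2.ne')
        rw [reflection, ← QuotientGroup.mk_mul, this]; rfl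
      rw [Monoid.CoprodI.Word.prod_cons, hm, map_mul, hρ] at hBg
      have hC : ((inversionU (c 2) * B : U21) : PU21) = ρ w.prod := by
        rw [QuotientGroup.mk_mul, hBg, ← mul_assoc]
        change reflection (c 2) * reflection (c 2) * _ = _
        rw [hsq, one_mul]
      rcases hhead w.fstIdx with h | h | h
      · exfalso
        have hw : w.prod = 1 := by
          induction w using Monoid.CoprodI.Word.consRecOn with
          | empty => simp
          | cons i m w h1 h2 _ => simp at h
        rw [hw, map_one, mul_one] at hBg
        obtain ⟨a, ha, hAB⟩ := exists_smul_of_coe_eq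
          (show ((inversionU (c 2) : U21) : PU21) = (B : PU21) from hBg.symm)
        -- If `B` were a multiple of the third reflection, the product in the third condition would
        -- be a multiple of `⟨e,e⟩ = 0`.
        have h3 := hB.2.2
        rw [hAB] at h3
        have h4 : (inversionU (c 2)).1.1 *ᵥ e = inversionMatrix v *ᵥ e := by
          rw [← N.inv2]; rfl
        rw [h4, herm_smul_left, inversionMatrix_herm (by rw [F.vv]; exact one_ne_zero), F.ee] at h3
        simp at h3
      · refine (houter w h _ hC ?_).elim
        rw [inversionU_mulVec, N.inv2]
        exact hB.2.1
      · exact absurd h h1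

/-- The ping-pong criterion for discreteness and faithfulness. -/
theorem isDiscreteRep_and_injective {c : Fin 3 → PolarVector} {e u v : Fin 3 → ℂ} {μ κ : ℂ}
    (N : IsNormalForm c e u v μ κ) (hμ : ∀ n : ℤ, 1 ≤ ‖conj μ + n * conj κ‖)
    (hκ : 1 ≤ ‖conj κ‖) (ρ : TriangleGroup →* PU21) (hρ : ∀ j, ρ (γ j) = reflection (c j)) :
    IsDiscreteRep ρ ∧ Function.Injective ρ := by
  have h1 := one_mem_nearOne N.frame
  constructor
  · apply discreteTopology_of_isOpen_singleton_one
    have hopen : IsOpen ((fun A : U21 => (A : PU21)) '' nearOne e u v) :=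
      QuotientGroup.isOpenMap_coe _ (isOpen_nearOne e u v)
    convert hopen.preimage (continuous_subtype_val (p := fun g => g ∈ ρ.range)) using 1
    ext ⟨g, w, hw⟩
    simp only [Set.mem_singleton_iff, Set.mem_preimage, Set.mem_image]
    constructor
    · intro h
      exact ⟨1, h1, (congrArg Subtype.val h).symm⟩
    · rintro ⟨B, hB, hBg⟩
      have := eq_one_of_mem_nearOne N hμ hκ ρ hρ w hB (hBg.trans hw.symm)
      apply Subtype.ext
      change g = 1
      rw [← hw, this, map_one]
  · rw [injective_iff_map_eq_one]
    intro g hg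
    exact eq_one_of_mem_nearOne N hμ hκ ρ hρ g h1 hg.symm

/-! ### Existence of the normal form -/

theorem inversionMatrix_smul {a : ℂ} (ha : a ≠ 0) (c : Fin 3 → ℂ) :
    inversionMatrix (a • c) = inversionMatrix c := by
  apply Matrix.toLin'.injective
  refine LinearMap.ext fun z => ?_
  have ha' : conj a ≠ 0 := by simpa using ha
  rw [Matrix.toLin'_apply, Matrix.toLin'_apply, inversionMatrix_mulVec, inversionMatrix_mulVec,
    smul_smul]
  congr 2
  rw [herm_smul_right, herm_smul_right, herm_smul_left]
  by_cases hc : herm c c = 0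
  · simp [hc]
  · field_simp

theorem exists_smul_herm_self (c : PolarVector) :
    ∃ a : ℂ, a ≠ 0 ∧ herm (a • c.1) (a • c.1) = 1 := by
  have hc := c.2
  have hs := Real.sqrt_pos.2 hc
  refine ⟨((Real.sqrt (hnorm c.1))⁻¹ : ℝ), by exact_mod_cast (inv_pos.2 hs).ne', ?_⟩
  rw [herm_self, hnorm_smul, Complex.norm_real, Real.norm_of_nonneg (inv_pos.2 hs).le, inv_pow,
    Real.sq_sqrt hc.le, inv_mul_cancel₀ hc.ne', Complex.ofReal_one]

theorem norm_herm_smul_sq {c d : Fin 3 → ℂ} (hc : 0 < hnorm c) (hd : 0 < hnorm d) {a b : ℂ}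
    (ha : herm (a • c) (a • c) = 1) (hb : herm (b • d) (b • d) = 1) :
    ‖herm (a • c) (b • d)‖ ^ 2 = ‖herm c d‖ ^ 2 / (hnorm c * hnorm d) := by
  have h1 : ‖a‖ ^ 2 * hnorm c = 1 := by
    rw [← hnorm_smul]; exact hnorm_eq_of_herm (by simpa using ha)
  have h2 : ‖b‖ ^ 2 * hnorm d = 1 := by
    rw [← hnorm_smul]; exact hnorm_eq_of_herm (by simpa using hb)
  rw [herm_smul_left, herm_smul_right, norm_mul, norm_mul, Complex.norm_conj,
    eq_div_iff (by positivity)]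
  linear_combination (‖herm c d‖ ^ 2 * ‖b‖ ^ 2 * hnorm d) * h1 + ‖herm c d‖ ^ 2 * h2

/-- After scaling to unit vectors with `⟨d,d₀⟩ = 1`, the difference `d - d₀` is null and orthogonal
to `d₀`, so it spans the ideal vertex. Its product with `v` is `κ`, nonzero because `r ≠ s`, so it
can be scaled to give `⟨e,v⟩ = 1`. -/
theorem exists_isNormalForm (c : Fin 3 → PolarVector) {r s : ℝ} (hr : 0 ≤ r) (hs : 0 ≤ s)
    (hrs : r ≠ s)
    (h12 : ‖herm (c 2).1 (c 1).1‖ ^ 2 / (hnorm (c 2).1 * hnorm (c 1).1) = r ^ 2)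
    (h02 : ‖herm (c 0).1 (c 2).1‖ ^ 2 / (hnorm (c 0).1 * hnorm (c 2).1) = s ^ 2)
    (h10 : ‖herm (c 1).1 (c 0).1‖ ^ 2 / (hnorm (c 1).1 * hnorm (c 0).1) = 1) :
    ∃ e u v μ κ, IsNormalForm c e u v μ κ ∧ ‖μ‖ = s ∧ ‖μ + κ‖ = r := by
  obtain ⟨a₀, ha₀, hd₀⟩ := exists_smul_herm_self (c 0)
  obtain ⟨a₁, ha₁, hd₁⟩ := exists_smul_herm_self (c 1)
  obtain ⟨a₂, ha₂, hd₂⟩ := exists_smul_herm_self (c 2)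
  rw [← norm_herm_smul_sq (c 2).2 (c 1).2 hd₂ hd₁] at h12
  rw [← norm_herm_smul_sq (c 0).2 (c 2).2 hd₀ hd₂] at h02
  rw [← norm_herm_smul_sq (c 1).2 (c 0).2 hd₁ hd₀] at h10
  have hi₀ := inversionMatrix_smul ha₀ (c 0).1
  have hi₁ := inversionMatrix_smul ha₁ (c 1).1
  have hi₂ := inversionMatrix_smul ha₂ (c 2).1
  set d₀ := a₀ • (c 0).1
  set d₁ := a₁ • (c 1).1
  set v := a₂ • (c 2).1
  clear_value d₀ d₁ v
  set t := herm d₁ d₀ with ht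
  have htt : conj t * t = 1 := by
    rw [Complex.conj_mul', ← Complex.ofReal_pow, h10, Complex.ofReal_one]
  have htn : ‖t‖ = 1 :=
    (pow_eq_one_iff_of_nonneg (norm_nonneg t) two_ne_zero).1 h10
  have ht0 : conj t ≠ 0 := left_ne_zero_of_mul_eq_one htt
  -- The phase of `d₁` is the only freedom used to turn `|⟨d₁,d₀⟩| = 1` into an exact `1`.
  set d := conj t • d₁ with hd
  have hdd₀ : herm d d₀ = 1 := by rw [hd, herm_smul_left, ← ht, htt]
  have hd₀d : herm d₀ d = 1 := by rw [← conj_herm, hdd₀, map_one]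
  have hdd : herm d d = 1 := by
    rw [hd, herm_smul_left, herm_smul_right, hd₁, Complex.conj_conj, mul_one, htt]
  set μ := herm d₀ v with hμ
  set κ := herm d v - μ with hκ
  have hμn : ‖μ‖ = s := (sq_eq_sq₀ (norm_nonneg _) hs).1 h02
  have hμκ : μ + κ = herm d v := by rw [hκ]; ring
  have hμκn : ‖μ + κ‖ = r := by
    rw [hμκ, hd, herm_smul_left, norm_mul, Complex.norm_conj, htn, one_mul, norm_herm_comm]
    exact (sq_eq_sq₀ (norm_nonneg _) hr).1 h12
  have hκ0 : κ ≠ 0 := by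
    intro h0
    rw [h0, add_zero, hμn] at hμκn
    exact hrs hμκn.symm
  set e := κ⁻¹ • (d - d₀) with he
  have hκe : κ • e = d - d₀ := by rw [he, smul_smul, mul_inv_cancel₀ hκ0, one_smul]
  have hee : herm e e = 0 := by
    rw [he]
    simp only [herm_smul_left, herm_smul_right, herm_sub_left, herm_sub_right, hdd, hdd₀, hd₀d,
      hd₀]
    ring
  have hed₀ : herm e d₀ = 0 := by
    rw [he]
    simp only [herm_smul_left, herm_sub_left, hdd₀, hd₀]
    ring
  have hd₀e : herm d₀ e = 0 := herm_eq_zero_comm hed₀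
  have hev : herm e v = 1 := by
    rw [he, herm_smul_left, herm_sub_left, ← hμ, ← hκ, inv_mul_cancel₀ hκ0]
  refine ⟨e, d₀ - μ • e, v, μ, κ, ⟨⟨hee, ?_, hd₂, ?_, hev, ?_⟩, ?_, ?_, ?_⟩, hμn, hμκn⟩
  · simp only [herm_sub_left, herm_sub_right, herm_smul_left, herm_smul_right, hd₀, hd₀e, hed₀,
      hee]
    ring
  · rw [herm_sub_right, herm_smul_right, hed₀, hee]
    ring
  · rw [herm_sub_left, herm_smul_left, hev, ← hμ]
    ring
  · rw [sub_add_cancel, hi₀]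
  · rw [add_smul, hκe]
    have : d₀ - μ • e + (μ • e + (d - d₀)) = d := by abel
    rw [this, hd, inversionMatrix_smul ht0, hi₁]
  · rw [hi₂]

/-! ### The elliptic element -/

/-- Each factor `I₂I₁` translates the parameter of the polar vector by `-κ`, as for half-turns about
equally spaced points. -/
theorem inversion_mul_pow {e u v : Fin 3 → ℂ} (F : IsFrame e u v) (μ κ : ℂ) (k : ℕ) :
    inversionMatrix (u + μ • e) *
      (inversionMatrix (u + (μ + κ) • e) * inversionMatrix (u + μ • e)) ^ k =
    inversionMatrix (u + (μ - k * κ) • e) := by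
  induction k with
  | zero => simp
  | succ k ih =>
    rw [pow_succ, ← mul_assoc, ih, ← mul_assoc]
    have h := F.inversion_mul_inversion_mul_inversion μ κ 0 1 (-k)
    have e₀ : μ + ((0 : ℝ) : ℂ) * κ = μ := by simp
    have e₁ : μ + ((1 : ℝ) : ℂ) * κ = μ + κ := by simp
    have e₂ : μ + ((-k : ℝ) : ℂ) * κ = μ - k * κ := by push_cast; ring
    have e₃ : μ + ((-k - 1 + 0 : ℝ) : ℂ) * κ = μ - (k + 1 : ℕ) * κ := by push_cast; ring
    rwa [e₀, e₁, e₂, e₃] at h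

theorem one_le_norm_of_not_isElliptic {c : Fin 3 → PolarVector} {e u v : Fin 3 → ℂ} {μ κ : ℂ}
    (N : IsNormalForm c e u v μ κ) (k : ℕ)
    (h : ¬ IsElliptic (reflection (c 0) * (reflection (c 1) * reflection (c 0)) ^ k *
      reflection (c 2))) : 1 ≤ ‖μ - k * κ‖ := by
  have F := N.frame
  by_contra hlt
  push Not at hlt
  apply h
  set ν := μ - k * κ with hν
  -- This vector is orthogonal to both `v` and `u + ν • e`, with norm `|ν|² - 1`. For `|ν| < 1` it
  -- is the common point of the two sides; both reflections act on it by `-1`.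
  set z := e - v + conj ν • u with hz
  have hzu : herm z u = conj ν := by
    simp [hz, herm_add_left, herm_sub_left, herm_smul_left, F.eu, F.vu, F.uu]
  have hze : herm z e = -1 := by
    simp [hz, herm_add_left, herm_sub_left, herm_smul_left, F.ee, F.ve, F.ue]
  have hzv : herm z v = 0 := by
    simp [hz, herm_add_left, herm_sub_left, herm_smul_left, F.ev, F.vv, F.uv]
  have hneg : hnorm z < 0 := by
    have : hnorm z = ‖ν‖ ^ 2 - 1 := by
      apply hnorm_eq_of_herm
      conv_lhs => arg 2; rw [hz]
      simp only [herm_add_right, herm_sub_right, herm_smul_right, hzu, hze, hzv, Complex.conj_conj]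
      rw [Complex.mul_conj']
      push_cast; ring
    rw [this]
    nlinarith [norm_nonneg ν]
  obtain ⟨p, a, -, hp⟩ := HC2.exists_vec_eq hneg
  refine ⟨p, inversionU (c 0) * (inversionU (c 1) * inversionU (c 0)) ^ k * inversionU (c 2),
    rfl, 1, ?_⟩
  have hmat : (inversionU (c 0) * (inversionU (c 1) * inversionU (c 0)) ^ k *
      inversionU (c 2)).1.1 = inversionMatrix (u + ν • e) * inversionMatrix v := by
    rw [hν, ← inversion_mul_pow F, ← N.inv0, ← N.inv1, ← N.inv2]
    simp only [Subgroup.coe_mul, Subgroup.coe_pow, Units.val_mul, Units.val_pow_eq_pow_val]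
    rfl
  rw [hmat, hp, Matrix.mulVec_smul, one_smul, ← Matrix.mulVec_mulVec, F.inversion_v, hzv,
    mul_zero, zero_smul, add_zero, Matrix.mulVec_neg, F.inversion_line, hzu, hze]
  simp

/-! ### The inequality on the parameters -/

/-- Let `f(x) = s + bx + ax²`. Eliminating `b` leaves `f(-m) = s - mst + m(m+1)a`, which is
nondecreasing in `a` for integer `m`. So the worst case is the least `a` allowed by `f(-k) ≥ 0`,
namely `s(tk-1)/(k(k+1))`, and `h1` says that this is at least `1`. -/
theorem quadratic_nonneg {s a b t : ℝ} {k : ℕ} (hk : 1 ≤ k) (hs : 0 < s) (hab : a + b = s * t)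
    (h1 : 1 / (k : ℝ) + ((k : ℝ) + 1) / s ≤ t) (h2 : 2 / (k : ℝ) ≤ t)
    (h3 : k ≠ 1 → t ≤ 2 / ((k : ℝ) - 1)) (hq : 0 ≤ s - k * b + k ^ 2 * a) :
    1 ≤ a ∧ ∀ n : ℤ, 0 ≤ s + n * b + n ^ 2 * a := by
  have hk0 : (0 : ℝ) < k := by exact_mod_cast hk
  have hkk : (0 : ℝ) < k * (k + 1) := by positivity
  obtain rfl : b = s * t - a := by linarith
  have ha : s * (t * k - 1) ≤ a * (k * (k + 1)) := by linarith
  have h1' : s + k * (k + 1) ≤ t * k * s := by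
    have := mul_le_mul_of_nonneg_right h1 (mul_pos hk0 hs).le
    have e : (1 / (k : ℝ) + ((k : ℝ) + 1) / s) * (k * s) = s + k * (k + 1) := by field_simp
    rw [e] at this
    linarith
  have h2' : 2 ≤ t * k := by rwa [div_le_iff₀ hk0] at h2
  refine ⟨?_, fun n => ?_⟩
  · by_contra hcon
    push Not at hcon
    nlinarith [mul_lt_mul_of_pos_right hcon hkk]
  obtain ⟨m, rfl⟩ : ∃ m : ℤ, n = -m := ⟨-n, by simp⟩
  have hm : (0 : ℝ) ≤ m * (m + 1) := by
    have : (0 : ℤ) ≤ m * (m + 1) := by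
      rcases le_or_gt 0 m with h | h
      · positivity
      · exact mul_nonneg_of_nonpos_of_nonpos h.le (by omega)
    exact_mod_cast this
  -- In the worst case `k(k+1) f(-m)` is `s` times this product, with zeros `k` and `(k+1)/(tk-1)`.
  -- The second zero is at most `k+1` by `h2` and at least `k-1` by `h3` (merely positive when `k =
  -- 1`), so no integer lies strictly between the two.
  have hroot : (0 : ℝ) ≤ (m - k) * ((t * k - 1) * m - (k + 1)) := by
    rcases lt_trichotomy m k with h | h | h
    · apply mul_nonneg_of_nonpos_of_nonpos
      · have : (m : ℝ) < k := by exact_mod_cast h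
        linarith
      · rcases le_or_gt m 0 with h0 | h0
        · have : (m : ℝ) ≤ 0 := by exact_mod_cast h0
          nlinarith
        · have hk2 : 2 ≤ k := by omega
          have hk1 : (0 : ℝ) < (k : ℝ) - 1 := by
            have : (2 : ℝ) ≤ k := by exact_mod_cast hk2
            linarith
          have h3' := h3 (by omega)
          rw [le_div_iff₀ hk1] at h3'
          have hmk : (m : ℝ) ≤ k - 1 := by
            have : m ≤ (k : ℤ) - 1 := by omega
            exact_mod_cast this
          have := mul_le_mul_of_nonneg_left hmk (show 0 ≤ t * k - 1 by linarith)
          nlinarith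
    · have : (m : ℝ) = k := by exact_mod_cast h
      simp [this]
    · have hmk : (k : ℝ) + 1 ≤ m := by exact_mod_cast h
      apply mul_nonneg (by linarith)
      nlinarith
  have key := mul_le_mul_of_nonneg_right ha hm
  have hfin : 0 ≤ (s - m * (s * t - a) + m ^ 2 * a) * (k * (k + 1)) := by
    have := mul_nonneg hs.le hroot
    nlinarith
  push_cast
  have := nonneg_of_mul_nonneg_left hfin hkk
  nlinarith

theorem norm_add_mul_sq (μ κ : ℂ) (x : ℝ) :
    ‖μ + x * κ‖ ^ 2 = ‖μ‖ ^ 2 + x * (2 * (μ * conj κ).re) + x ^ 2 * ‖κ‖ ^ 2 := by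
  simp [Complex.sq_norm, Complex.normSq_apply]; ring

theorem one_le_norm_add_intCast_mul {μ κ : ℂ} {r s : ℝ} (hμ : ‖μ‖ = s) (hμκ : ‖μ + κ‖ = r)
    (hs : 1 < s) {k : ℕ} (hk : 1 ≤ k)
    (hlower : max (1 / (k : ℝ) + ((k : ℝ) + 1) / (s ^ 2 - 1)) (2 / (k : ℝ)) ≤
      (r ^ 2 - 1) / (s ^ 2 - 1) - 1)
    (hupper : k ≠ 1 → (r ^ 2 - 1) / (s ^ 2 - 1) - 1 ≤ 2 / ((k : ℝ) - 1))
    (h : 1 ≤ ‖μ - k * κ‖) :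
    (∀ n : ℤ, 1 ≤ ‖conj μ + n * conj κ‖) ∧ 1 ≤ ‖conj κ‖ := by
  have hs' : 0 < s ^ 2 - 1 := by nlinarith
  obtain ⟨h1, h2⟩ := max_le_iff.1 hlower
  have hexp := norm_add_mul_sq μ κ
  have e1 := hexp 1
  rw [Complex.ofReal_one, one_mul, hμ, hμκ] at e1
  have ek := hexp (-k)
  have hk' : μ + ((-k : ℝ) : ℂ) * κ = μ - k * κ := by push_cast; ring
  rw [hk', hμ] at ek
  have hsq : 1 ≤ ‖μ - k * κ‖ ^ 2 := one_le_pow₀ h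
  obtain ⟨ha, hn⟩ := quadratic_nonneg (a := ‖κ‖ ^ 2) (b := 2 * (μ * conj κ).re) hk hs'
    (by field_simp; linarith) h1 h2 hupper (by linarith)
  constructor
  · intro n
    have e : conj μ + n * conj κ = conj (μ + (n : ℝ) * κ) := by simp
    rw [e, Complex.norm_conj]
    have := hexp n
    rw [hμ] at this
    have h' : 1 ≤ ‖μ + (n : ℝ) * κ‖ ^ 2 := by linarith [hn n]
    exact (one_le_sq_iff₀ (norm_nonneg _)).1 h'
  · rw [Complex.norm_conj]
    exact (one_le_sq_iff₀ (norm_nonneg _)).1 ha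

/-! ### Discrete groups have no elliptic elements of infinite order -/

/-- The positive definite form obtained by changing the sign of the Hermitian form on a negative
line. -/
noncomputable def definiteForm (z y : Fin 3 → ℂ) : ℝ := hnorm y - 2 * ‖herm y z‖ ^ 2 / hnorm z

theorem definiteForm_pos {z : Fin 3 → ℂ} (hz : hnorm z < 0) {y : Fin 3 → ℂ} (hy : y ≠ 0) :
    0 < definiteForm z y := by
  have e : definiteForm z y = hnorm (perp z y) + ‖herm y z‖ ^ 2 / -hnorm z := by
    rw [hnorm_perp hz.ne, definiteForm, div_neg]; ring
  rw [e]
  by_cases h : herm y z = 0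
  · have : perp z y = y := by simp [perp, h]
    rw [this, h]
    have := hnorm_pos_of_orth hz h hy
    simpa using this
  · have h1 := hnorm_nonneg_of_orth hz (herm_perp_left hz.ne y)
    have h2 := norm_pos_iff.2 h
    have h3 : 0 < -hnorm z := by linarith
    positivity

theorem definiteForm_smul (z : Fin 3 → ℂ) (a : ℂ) (y : Fin 3 → ℂ) :
    definiteForm z (a • y) = ‖a‖ ^ 2 * definiteForm z y := by
  rw [definiteForm, definiteForm, hnorm_smul, herm_smul_left, norm_mul]; ring

/-- The constant is the minimum of the form on the compact unit sphere. -/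
theorem exists_norm_sq_le_definiteForm {z : Fin 3 → ℂ} (hz : hnorm z < 0) :
    ∃ C : ℝ, 0 < C ∧ ∀ y, C * ‖y‖ ^ 2 ≤ definiteForm z y := by
  have hcont : Continuous (definiteForm z) := by
    unfold definiteForm
    exact continuous_hnorm.sub
      ((continuous_const.mul ((continuous_herm_left z).norm.pow 2)).div_const _)
  obtain ⟨y₀, hy₀, hmin⟩ := (isCompact_sphere (0 : Fin 3 → ℂ) 1).exists_isMinOn
    (NormedSpace.sphere_nonempty.2 zero_le_one) hcont.continuousOn
  have hy₀' : y₀ ≠ 0 := by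
    rintro rfl
    simp at hy₀
  refine ⟨definiteForm z y₀, definiteForm_pos hz hy₀', fun y => ?_⟩
  by_cases hy : y = 0
  · simp [hy, definiteForm, hnorm, herm]
  have hny := norm_pos_iff.2 hy
  have hmem : (((‖y‖⁻¹ : ℝ) : ℂ) • y) ∈ Metric.sphere (0 : Fin 3 → ℂ) 1 := by
    rw [mem_sphere_zero_iff_norm, norm_smul, Complex.norm_real, Real.norm_of_nonneg (by positivity),
      inv_mul_cancel₀ hny.ne']
  have := hmin hmem
  simp only [Set.mem_ofPred_eq] at this
  rw [definiteForm_smul, Complex.norm_real, Real.norm_of_nonneg (by positivity), inv_pow,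
    inv_mul_eq_div, le_div_iff₀ (by positivity)] at this
  exact this

theorem definiteForm_mulVec {A : U21} {z : Fin 3 → ℂ} (hz : hnorm z < 0) {μ : ℂ}
    (hA : A.1.1 *ᵥ z = μ • z) (y : Fin 3 → ℂ) :
    definiteForm z (A.1.1 *ᵥ y) = definiteForm z y := by
  have h1 : ‖μ‖ ^ 2 = 1 := by
    have := hnorm_mulVec A z
    rw [hA, hnorm_smul] at this
    exact mul_right_cancel₀ hz.ne (by linarith)
  have h2 : ‖herm (A.1.1 *ᵥ y) z‖ ^ 2 = ‖herm y z‖ ^ 2 := by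
    have := A.2 y z
    rw [hA, herm_smul_right] at this
    rw [← this, norm_mul, Complex.norm_conj, mul_pow, h1, one_mul]
  rw [definiteForm, definiteForm, hnorm_mulVec, h2]

/-- The stabiliser of a negative line preserves a positive definite form. Inverses are bounded too
because the topology of the unit group controls both a matrix and its inverse. -/
theorem exists_bound_pow {A : U21} {z : Fin 3 → ℂ} (hz : hnorm z < 0) {μ : ℂ}
    (hA : A.1.1 *ᵥ z = μ • z) :
    ∃ R : ℝ, ∀ n : ℕ, ∀ i j, ‖(A ^ n).1.1 i j‖ ≤ R ∧ ‖(A ^ n)⁻¹.1.1 i j‖ ≤ R := by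
  have hpow : ∀ (n : ℕ) y, definiteForm z ((A ^ n).1.1 *ᵥ y) = definiteForm z y := by
    intro n
    induction n with
    | zero => intro y; simp
    | succ n ih =>
      intro y
      have : (A ^ (n + 1)).1.1 *ᵥ y = (A ^ n).1.1 *ᵥ (A.1.1 *ᵥ y) := by
        rw [Matrix.mulVec_mulVec, pow_succ]; rfl
      rw [this, ih, definiteForm_mulVec hz hA]
  have hinv : ∀ (n : ℕ) y, definiteForm z ((A ^ n)⁻¹.1.1 *ᵥ y) = definiteForm z y := by
    intro n y
    rw [← hpow n]
    have : (A ^ n).1.1 *ᵥ ((A ^ n)⁻¹.1.1 *ᵥ y) = y := by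
      rw [Matrix.mulVec_mulVec]
      have h : (A ^ n).1.1 * (A ^ n)⁻¹.1.1 = 1 := (A ^ n).1.val_inv
      rw [h, Matrix.one_mulVec]
    rw [this]
  obtain ⟨C, hC, hle⟩ := exists_norm_sq_le_definiteForm hz
  set D := ∑ j : Fin 3, definiteForm z (Pi.single j 1) with hD
  have hD1 : ∀ j : Fin 3, definiteForm z (Pi.single j 1) ≤ D := fun j =>
    Finset.single_le_sum (f := fun j : Fin 3 => definiteForm z (Pi.single j 1))
      (fun i _ => (definiteForm_pos hz (by simp)).le) (Finset.mem_univ j)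
  have hbound : ∀ B : Matrix (Fin 3) (Fin 3) ℂ,
      (∀ y, definiteForm z (B *ᵥ y) = definiteForm z y) →
      ∀ i j, ‖B i j‖ ≤ Real.sqrt (D / C) := by
    intro B hB i j
    apply Real.le_sqrt_of_sq_le
    have h1 := (hle (B *ᵥ Pi.single j 1)).trans ((hB _).trans_le (hD1 j))
    have h2 : ‖B i j‖ ≤ ‖B *ᵥ Pi.single j 1‖ := by
      have := norm_le_pi_norm (B *ᵥ Pi.single j 1) i
      simpa using this
    rw [le_div_iff₀ hC]
    have h3 : ‖B i j‖ ^ 2 ≤ ‖B *ᵥ Pi.single j 1‖ ^ 2 := by gcongr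
    nlinarith
  exact ⟨_, fun n i j => ⟨hbound _ (hpow n) i j, hbound _ (hinv n) i j⟩⟩

/-- The powers of an elliptic element of `U(2,1)` accumulate at the identity. -/
theorem exists_tendsto_pow_one {A : U21} {z : Fin 3 → ℂ} (hz : hnorm z < 0) {μ : ℂ}
    (hA : A.1.1 *ᵥ z = μ • z) :
    ∃ d : ℕ → ℕ, (∀ n, 0 < d n) ∧
      Filter.Tendsto (fun n => A ^ d n) Filter.atTop (nhds 1) := by
  obtain ⟨R, hR⟩ := exists_bound_pow hz hA
  set S : Set (Fin 3 → Fin 3 → ℂ) :=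
    Set.pi Set.univ fun _ => Set.pi Set.univ fun _ => Metric.closedBall 0 R with hS
  have hScomp : IsCompact S :=
    isCompact_univ_pi fun _ => isCompact_univ_pi fun _ => isCompact_closedBall 0 R
  have hmem : ∀ n : ℕ, (((A ^ n).1.1, (A ^ n)⁻¹.1.1) :
      (Fin 3 → Fin 3 → ℂ) × (Fin 3 → Fin 3 → ℂ)) ∈ S ×ˢ S := by
    intro n
    constructor
    · intro i _ j _
      simpa using (hR n i j).1
    · intro i _ j _
      simpa using (hR n i j).2
  obtain ⟨φ, hφ, X, Y, hX, hY⟩ : ∃ φ : ℕ → ℕ, StrictMono φ ∧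
      ∃ X Y : Matrix (Fin 3) (Fin 3) ℂ,
        Filter.Tendsto (fun n => (A ^ φ n).1.1) Filter.atTop (nhds X) ∧
        Filter.Tendsto (fun n => (A ^ φ n)⁻¹.1.1) Filter.atTop (nhds Y) := by
    obtain ⟨⟨X, Y⟩, -, φ, hφ, hlim⟩ := (hScomp.prod hScomp).tendsto_subseq hmem
    exact ⟨φ, hφ, X, Y, (continuous_fst.tendsto _).comp hlim,
      (continuous_snd.tendsto _).comp hlim⟩
  have hXY : X * Y = 1 := by
    have h1 := hX.mul hY
    have h2 : ∀ n, (A ^ φ n).1.1 * (A ^ φ n)⁻¹.1.1 = 1 := fun n => (A ^ φ n).1.val_inv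
    simp only [h2] at h1
    exact tendsto_nhds_unique h1 tendsto_const_nhds
  let U : GL (Fin 3) ℂ := ⟨X, Y, hXY, mul_eq_one_comm.1 hXY⟩
  have hU : Filter.Tendsto (fun n => (A ^ φ n).1) Filter.atTop (nhds U) := by
    rw [Units.isInducing_embedProduct.tendsto_nhds_iff]
    exact hX.prodMk_nhds ((MulOpposite.continuous_op.tendsto _).comp hY)
  -- Quotients of consecutive terms of a convergent subsequence tend to the identity; strict
  -- monotonicity makes the exponents positive.
  refine ⟨fun n => φ (n + 1) - φ n, fun n => Nat.sub_pos_of_lt (hφ n.lt_succ_self), ?_⟩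
  rw [tendsto_subtype_rng]
  have h1 := (hU.comp (Filter.tendsto_add_atTop_nat 1)).mul hU.inv
  rw [mul_inv_cancel] at h1
  refine h1.congr fun n => ?_
  change (A ^ φ (n + 1) * (A ^ φ n)⁻¹).1 = _
  rw [pow_sub A (hφ n.lt_succ_self).le]

theorem exists_pow_eq_one_of_isElliptic (ρ : TriangleGroup →* PU21) (h : IsDiscreteRep ρ)
    (w : TriangleGroup) (hw : IsElliptic (ρ w)) : ∃ d : ℕ, 0 < d ∧ ρ (w ^ d) = 1 := by
  obtain ⟨p, A, hA, μ, hμ⟩ := hw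
  obtain ⟨d, hd, hlim⟩ := exists_tendsto_pow_one p.hnorm_vec hμ
  have h1 : Filter.Tendsto (fun n => ((A ^ d n : U21) : PU21)) Filter.atTop (nhds 1) :=
    (QuotientGroup.continuous_mk.tendsto (1 : U21)).comp hlim
  have h2 : Filter.Tendsto (fun n => (⟨ρ (w ^ d n), w ^ d n, rfl⟩ : ρ.range)) Filter.atTop
      (nhds 1) := by
    rw [tendsto_subtype_rng]
    refine h1.congr fun n => ?_
    change QuotientGroup.mk' scalars (A ^ d n) = ρ (w ^ d n)
    rw [map_pow, map_pow, ← hA]; rfl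
  have : DiscreteTopology ρ.range := h
  rw [nhds_discrete, Filter.tendsto_pure] at h2
  obtain ⟨n, hn⟩ := h2.exists
  exact ⟨d n, hd n, congrArg Subtype.val hn⟩

/-- The homomorphism from the group of order two determined by an involution. -/
def involutionHom {G : Type*} [Group G] (g : G) (hg : g * g = 1) :
    Multiplicative (ZMod 2) →* G where
  toFun m := if m = 1 then 1 else g
  map_one' := by simp
  map_mul' a b := by
    have h : ∀ a : Multiplicative (ZMod 2), a = 1 ∨ a = Multiplicative.ofAdd 1 := by decide
    have h1 : (Multiplicative.ofAdd 1 : Multiplicative (ZMod 2)) ≠ 1 := by decide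
    have h2 : (Multiplicative.ofAdd 1 * Multiplicative.ofAdd 1 : Multiplicative (ZMod 2)) = 1 := by
      decide
    rcases h a with rfl | rfl <;> rcases h b with rfl | rfl <;>
      simp only [one_mul, mul_one, if_true, if_neg h1, h2, hg]

theorem involutionHom_ofAdd_one {G : Type*} [Group G] (g : G) (hg : g * g = 1) :
    involutionHom g hg (Multiplicative.ofAdd 1) = g := by
  have h : (Multiplicative.ofAdd 1 : Multiplicative (ZMod 2)) ≠ 1 := by decide
  change (if (Multiplicative.ofAdd 1 : Multiplicative (ZMod 2)) = 1 then 1 else g) = g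
  rw [if_neg h]

/-- The element of the free product whose image is tested for ellipticity has infinite order. -/
theorem pow_word_ne_one (k : ℕ) {d : ℕ} (hd : 0 < d) :
    (γ 0 * (γ 1 * γ 0) ^ k * γ 2) ^ d ≠ 1 := by
  -- Sending the first two generators to the same reflection kills `γ 1 * γ 0`, so the word maps to
  -- the generating rotation of the infinite dihedral group.
  let f : Fin 3 → DihedralGroup 0 := ![.sr 0, .sr 0, .sr 1]
  have hf : ∀ j, f j * f j = 1 := by
    intro j
    fin_cases j <;> exact DihedralGroup.sr_mul_self _
  let φ : TriangleGroup →* DihedralGroup 0 :=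
    Monoid.CoprodI.lift fun j => involutionHom (f j) (hf j)
  have hφ : ∀ j, φ (γ j) = f j := by
    intro j
    simp only [φ, γ, Monoid.CoprodI.lift_of]
    exact involutionHom_ofAdd_one (f j) (hf j)
  intro h
  have h1 := congrArg φ h
  simp only [map_pow, map_mul, hφ, map_one] at h1
  have h2 : f 1 * f 0 = 1 := hf 0
  have h3 : f 0 * f 2 = DihedralGroup.r 1 := by
    change DihedralGroup.sr 0 * DihedralGroup.sr 1 = _
    rw [DihedralGroup.sr_mul_sr, sub_zero]
  rw [h2, one_pow, mul_one, h3, ← orderOf_dvd_iff_pow_eq_one, DihedralGroup.orderOf_r_one,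
    zero_dvd_iff] at h1
  omega

end CHyp

/-! ### The equivalence -/

theorem proposition1 (m₁ m₂ r₁ r₂ : ℝ) (hm : m₂ ≤ m₁) (hm₂ : 0 < m₂)
    (hr₁ : r₁ = Real.cosh (m₁ / 2)) (hr₂ : r₂ = Real.cosh (m₂ / 2))
    (k : ℕ) (hk : 1 ≤ k)
    (hlower : max (1 / (k : ℝ) + ((k : ℝ) + 1) / (r₂ ^ 2 - 1)) (2 / (k : ℝ)) ≤
      (r₁ ^ 2 - 1) / (r₂ ^ 2 - 1) - 1)
    (hupper : k ≠ 1 → (r₁ ^ 2 - 1) / (r₂ ^ 2 - 1) - 1 ≤ 2 / ((k : ℝ) - 1))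
    (ρ : CHyp.TriangleGroup →* CHyp.PU21) (hρ : CHyp.IsTriangleRep ![m₁, m₂, 0] ρ)
    (I₁ I₂ I₃ : CHyp.PU21)
    (hI₁ : I₁ = ρ (CHyp.γ 0)) (hI₂ : I₂ = ρ (CHyp.γ 1)) (hI₃ : I₃ = ρ (CHyp.γ 2)) :
    (CHyp.IsDiscreteRep ρ ∧ Function.Injective ρ) ↔
      ¬ CHyp.IsElliptic (I₁ * (I₂ * I₁) ^ k * I₃) := by
  subst hI₁ hI₂ hI₃
  constructor
  · rintro ⟨hdisc, hinj⟩ hell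
    simp only [← map_mul, ← map_pow] at hell
    obtain ⟨d, hd, h⟩ := CHyp.exists_pow_eq_one_of_isElliptic ρ hdisc _ hell
    exact CHyp.pow_word_ne_one k hd (hinj (h.trans (map_one ρ).symm))
  · intro hell
    obtain ⟨c, htri, hc⟩ := hρ
    obtain ⟨hd₀, hm₀⟩ := htri 0
    obtain ⟨hd₁, hm₁⟩ := htri 1
    obtain ⟨hd₂, hm₂'⟩ := htri 2
    have h12 := CHyp.cosh_setDist_sq _ _ hd₀
    have h02 := CHyp.cosh_setDist_sq _ _ hd₁
    have h10 := CHyp.cosh_setDist_sq _ _ hd₂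
    rw [hm₀] at h12
    rw [hm₁] at h02
    rw [hm₂'] at h10
    simp only [Matrix.cons_val] at h12 h02 h10
    rw [← hr₁] at h12
    rw [← hr₂] at h02
    rw [zero_div, Real.cosh_zero, one_pow] at h10
    have hr₂1 : 1 < r₂ := by rw [hr₂, Real.one_lt_cosh]; positivity
    -- Equality would make the middle term of the hypothesis zero, below `2/k`. This is what makes
    -- `κ` nonzero in the normal form.
    have hne : r₁ ≠ r₂ := by
      rintro rfl
      have h2 := (le_max_right _ _).trans hlower
      rw [div_self (by nlinarith), sub_self] at h2
      have : (0 : ℝ) < 2 / k := by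
        have : (0 : ℝ) < k := by exact_mod_cast hk
        positivity
      linarith
    obtain ⟨e, u, v, μ, κ, N, hμ, hμκ⟩ := CHyp.exists_isNormalForm c
      (r := r₁) (s := r₂) (by rw [hr₁]; positivity) (by positivity) hne h12.symm h02.symm h10.symm
    rw [hc, hc, hc] at hell
    obtain ⟨h1, h2⟩ := CHyp.one_le_norm_add_intCast_mul hμ hμκ hr₂1 hk hlower hupper
      (CHyp.one_le_norm_of_not_isElliptic N k hell)
    exact CHyp.isDiscreteRep_and_injective N h1 h2 ρ hc
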